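/- Let $n\ge 1$, $T>0$, let $(\Omega,\mathcal F,\mathbb Q)$ be a probability space (interest rate $0$) and let $S_1,\dots,S_n$ be real-valued processes on $[0,T]$ with $S_i(t)\ge 0$ a.s. for each $t$, with a.s. right-continuous paths, and such that for each $i$ the supremum $\sup_{0\le t\le T}S_i(t)$ is a.s. finite and $\mathbb Q$-integrable. Let $\mu$ be the space-time control measure \[\mu(A\times B)=\int_{A\cap[0,T]}\mathbb Q\big((S_1(t),\dots,S_n(t))\in B\big)\,dt ,\qquad A\subset\mathbb R,\ B\subset\mathbb R^n\ \text{Borel},\] and assume that $\mu$ is absolutely continuous with respect to the Lebesgue measure $m_{n+1}$. For $0\le T_0\le T_1\le T$ and $x,K\in\mathbb R^n$ put \[V_{ML}(T_0,T_1,x)=\mathbb E_{\mathbb Q}\sup_{T_0\le u\le T_1,\ i}(S_i(u)-x_i)^+,\qquad V_{AB}(K)=\mathbb E_{\mathbb Q}\int_0^T\sum_i (S_i(t)-K_i)^+\,dt ,\] the prices of the multi-asset look-back and of the Asian basket option. Then: (1) The payoffs in both definitions are $\mathbb Q$-integrable, and for every window $[T_0,T_1]\subset[0,T]$ the first-order partial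 derivatives of $x\mapsto V_{ML}(T_0,T_1,x)$ exist at a.e. $x\in\mathbb R^n$. (2) For a.e. $t\in(0,T)$, for all $x\in(0,\infty)^n$ and all $i$: the limit $V_0(t,x)=\lim_{s\to0^+}V_{ML}(t,t+s,x)$ exists, its partial derivative $\partial V_0(t,x)/\partial x_i$ exists, the one-sided (left and right) partial derivatives in $x_i$ of $V_{ML}(t,t+s,\cdot)$ at $x$ exist whenever $s>0$ and $t+s\le T$, and both converge to $\partial V_0(t,x)/\partial x_i$ as $s\to0^+$. Write \[\frac{\partial}{\partial x_i}V_{ML}(t,t+s,x)\Big|_{s=0^+}:=\frac{\partial}{\partial x_i}V_0(t,x).\] (3) For a.e. $(t,x)\in(0,T)\times(0,\infty)^n$ the iterated partial derivative \[q(t,x)=\frac{\partial^n}{\partial x_1\cdots\partial x_n}\sum_i\frac{\partial}{\partial x_i}V_{ML}(t,t+s,x)\Big|_{s=0^+}\] exists, and it equals the density $\dfrac{d\mu}{dm_{n+1}}(t,x)$ (the time-dependent multi-asset state-price density). (4) For every $K\in\mathbb R^n$ and every $i$ the function $(x_i-K_i)^+q(t,x)$ is integrable on $(0,T)\times(0,\infty)^n$,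 and \[V_{AB}(K)=\sum_i\int_0^T\int_0^\infty\!\!\cdots\int_0^\infty (x_i-K_i)^+\,q(t,x)\,dx_1\cdots dx_n\,dt .\] -/

import Mathlib

open MeasureTheory Filter Topology Set

noncomputable section

/-- The state space `(0,∞)^n`. -/
def positiveOrthant (n : ℕ) : Set (Fin n → ℝ) := {x | ∀ i, 0 < x i}

/-- Partial derivative of `f` in the `i`-th coordinate at `x`. -/
def partialDeriv {n : ℕ} (i : Fin n) (f : (Fin n → ℝ) → ℝ) (x : Fin n → ℝ) : ℝ :=
  deriv (fun y => f (Function.update x i y)) (x i)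

/-- The `i`-th partial derivative of `f` exists (two-sided, finite) at `x`. -/
def PartialExists {n : ℕ} (i : Fin n) (f : (Fin n → ℝ) → ℝ) (x : Fin n → ℝ) : Prop :=
  DifferentiableAt ℝ (fun y => f (Function.update x i y)) (x i)

/-- Iterated partial derivative: `iteratedPartial [i₁, …, iₖ] f = ∂_{i₁} (⋯ (∂_{iₖ} f))`. -/
def iteratedPartial {n : ℕ} : List (Fin n) → ((Fin n → ℝ) → ℝ) → (Fin n → ℝ) → ℝ
  | [], f => f
  | i :: l, f => partialDeriv i (iteratedPartial l f)

/-- The iterated partial derivative `∂_{i₁} (⋯ (∂_{iₖ} f))` genuinely exists at `x`: the inner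
derivatives exist at all points near `x` on the coordinate line through `x` along which the outer
derivative is taken, and the outer derivative exists at `x`. -/
def IteratedPartialExists {n : ℕ} :
    List (Fin n) → ((Fin n → ℝ) → ℝ) → (Fin n → ℝ) → Prop
  | [], _, _ => True
  | i :: l, f, x =>
      (∀ᶠ y in 𝓝 (x i), IteratedPartialExists l f (Function.update x i y)) ∧
        PartialExists i (iteratedPartial l f) x

section Market

variable {Ω : Type*} [MeasurableSpace Ω] {n : ℕ}

/-- Payoff of the multi-asset look-back option on the window `[T₀, T₁]`:
`max_{T₀ ≤ u ≤ T₁, i} (S_i(u) - x_i)^+`, the maximum being read as a supremum. -/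
def lookbackPayoff (S : Fin n → ℝ → Ω → ℝ) (T₀ T₁ : ℝ) (x : Fin n → ℝ) (ω : Ω) : ℝ :=
  ⨆ i, ⨆ u : Icc T₀ T₁, max (S i u ω - x i) 0

/-- Price of the multi-asset look-back option (zero interest rate). -/
def lookbackPrice (Q : Measure Ω) (S : Fin n → ℝ → Ω → ℝ) (T₀ T₁ : ℝ) (x : Fin n → ℝ) : ℝ :=
  ∫ ω, lookbackPayoff S T₀ T₁ x ω ∂Q

/-- Payoff of the Asian basket option: `∫₀ᵀ ∑ i, (S_i(t) - K_i)^+ dt`. -/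
def asianBasketPayoff (S : Fin n → ℝ → Ω → ℝ) (T : ℝ) (K : Fin n → ℝ) (ω : Ω) : ℝ :=
  ∫ t in (0 : ℝ)..T, ∑ i, max (S i t ω - K i) 0

/-- Price of the Asian basket option (zero interest rate). -/
def asianBasketPrice (Q : Measure Ω) (S : Fin n → ℝ → Ω → ℝ) (T : ℝ) (K : Fin n → ℝ) : ℝ :=
  ∫ ω, asianBasketPayoff S T K ω ∂Q

/-- The space-time control measure `μ(A × B) = ∫_{A ∩ [0,T]} Q(S_t ∈ B) dt`: the image of
`dt ⊗ Q` on `[0,T] × Ω` under `(t, ω) ↦ (t, S_t(ω))`. (For processes with almost surely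
right-continuous paths this map is almost everywhere measurable, see
`aemeasurable_spaceTime` below.) -/
def controlMeasure (Q : Measure Ω) (S : Fin n → ℝ → Ω → ℝ) (T : ℝ) :
    Measure (ℝ × (Fin n → ℝ)) :=
  Measure.map (fun p : ℝ × Ω => (p.1, fun i => S i p.1 p.2))
    ((volume.restrict (Icc 0 T)).prod Q)

/-- The look-back price at `s = 0⁺`: `lim_{s → 0⁺} V_{ML}(t, t+s, x)`. -/
def instantLookbackPrice (Q : Measure Ω) (S : Fin n → ℝ → Ω → ℝ) (t : ℝ) (x : Fin n → ℝ) : ℝ :=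
  limUnder (𝓝[>] (0 : ℝ)) (fun s => lookbackPrice Q S t (t + s) x)

/-- `∑ i, ∂/∂x_i V_{ML}(t, t+s, x) |_{s = 0⁺}`. -/
def sumLookbackPartials (Q : Measure Ω) (S : Fin n → ℝ → Ω → ℝ) (t : ℝ) (x : Fin n → ℝ) : ℝ :=
  ∑ i, partialDeriv i (instantLookbackPrice Q S t) x

/-- `∂ⁿ/∂x₁⋯∂xₙ ∑ i, ∂/∂x_i V_{ML}(t, t+s, x) |_{s = 0⁺}`, the time-dependent multi-asset
state-price density. -/
def statePriceDensity (Q : Measure Ω) (S : Fin n → ℝ → Ω → ℝ) (t : ℝ) (x : Fin n → ℝ) : ℝ :=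
  iteratedPartial (List.finRange n) (sumLookbackPartials Q S t) x

/-- For a process with measurable marginals and almost surely right-continuous paths, the
space-time map defining the control measure is almost everywhere measurable. -/
theorem aemeasurable_spaceTime (Q : Measure Ω) [SFinite Q] (S : Fin n → ℝ → Ω → ℝ) (T : ℝ)
    (hmeas : ∀ i, ∀ t ∈ Icc 0 T, Measurable (S i t))
    (hrc : ∀ i, ∀ᵐ ω ∂Q, ∀ t ∈ Ico 0 T, ContinuousWithinAt (fun u => S i u ω) (Ici t) t) :
    AEMeasurable (fun p : ℝ × Ω => (p.1, fun i => S i p.1 p.2))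
      ((volume.restrict (Icc 0 T)).prod Q) := by
  refine measurable_fst.aemeasurable.prodMk (aemeasurable_pi_lambda _ fun i => ?_)
  -- the grid point strictly to the right of `t`, capped at `T` and kept nonnegative
  let g : ℕ → ℤ → ℝ := fun k m => max 0 (min T ((m + 1 : ℝ) / (k + 1)))
  let J : ℕ → ℝ → ℤ := fun k t => ⌊t * (k + 1)⌋
  rcases lt_or_ge T 0 with hT | hT
  · rw [Icc_eq_empty (not_le.2 hT)]
    simp
  have hg : ∀ k m, g k m ∈ Icc 0 T := fun k m =>
    ⟨le_max_left _ _, max_le hT (min_le_left _ _)⟩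
  refine aemeasurable_of_tendsto_metrizable_ae (u := atTop)
    (f := fun (k : ℕ) (p : ℝ × Ω) => S i (g k (J k p.1)) p.2) (fun k => ?_) ?_
  · have h1 : Measurable (fun q : ℤ × Ω => S i (g k q.1) q.2) :=
      measurable_from_prod_countable_right fun m => hmeas i _ (hg k m)
    have h2 : Measurable (fun p : ℝ × Ω => (J k p.1, p.2)) :=
      ((Int.measurable_floor.comp (measurable_fst.mul_const _))).prodMk measurable_snd
    exact (h1.comp h2).aemeasurable
  · have hω : ∀ᵐ p ∂((volume.restrict (Icc 0 T)).prod Q), ∀ t ∈ Ico 0 T,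
        ContinuousWithinAt (fun u => S i u p.2) (Ici t) t :=
      Measure.quasiMeasurePreserving_snd.ae (hrc i)
    have ht : ∀ᵐ t ∂(volume.restrict (Icc (0 : ℝ) T)), t ∈ Ico 0 T := by
      rw [← restrict_Ico_eq_restrict_Icc]
      exact ae_restrict_mem measurableSet_Ico
    have ht' : ∀ᵐ p ∂((volume.restrict (Icc 0 T)).prod Q), p.1 ∈ Ico 0 T :=
      Measure.quasiMeasurePreserving_fst.ae ht
    filter_upwards [hω, ht'] with p hp hpt
    refine (hp p.1 hpt).tendsto.comp (tendsto_nhdsWithin_iff.2 ⟨?_, ?_⟩)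
    · have hlim : Tendsto (fun k : ℕ => ((J k p.1 : ℝ) + 1) / (k + 1)) atTop (𝓝 p.1) := by
        have hup : Tendsto (fun k : ℕ => p.1 + 1 / ((k : ℝ) + 1)) atTop (𝓝 p.1) := by
          simpa using tendsto_const_nhds.add (tendsto_one_div_add_atTop_nhds_zero_nat (𝕜 := ℝ))
        refine tendsto_of_tendsto_of_tendsto_of_le_of_le tendsto_const_nhds hup ?_ ?_
        · intro k
          have hk : (0 : ℝ) < k + 1 := by positivity
          change p.1 ≤ ((J k p.1 : ℝ) + 1) / (k + 1)
          rw [le_div_iff₀ hk]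
          exact (Int.lt_floor_add_one _).le
        · intro k
          have hk : (0 : ℝ) < k + 1 := by positivity
          change ((J k p.1 : ℝ) + 1) / (k + 1) ≤ p.1 + 1 / ((k : ℝ) + 1)
          rw [add_div]
          gcongr
          rw [div_le_iff₀ hk]
          exact Int.floor_le _
      have h := (tendsto_const_nhds (x := (0 : ℝ)) (f := atTop (α := ℕ))).max
        ((tendsto_const_nhds (x := T)).min hlim)
      rwa [min_eq_right hpt.2.le, max_eq_right hpt.1] at h
    · refine Eventually.of_forall fun k => ?_
      have hk : (0 : ℝ) < k + 1 := by positivity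
      refine le_max_of_le_right (le_min hpt.2.le ?_)
      rw [le_div_iff₀ hk]
      exact (Int.lt_floor_add_one _).le

end Market

end

/-! Right-continuity collapses the window: as `s → 0⁺` the look-back price tends to the expectation
of `max_i (S_i(t) - x_i)^+`. For a.e. `t` the law of `S(t)` has a density (`ae_map_eq_withDensity`),
so almost surely no `S_i(t) - x_i` vanishes and no two coincide. The payoff is then differentiable
in each `x_i`, with slope `-1` if asset `i` is in the money and best, and `0` otherwise. Exactly one
asset is best when some asset is in the money, so the slopes add up to the indicator of `S(t) ≤ x`
minus `1`. Taking expectations, the sum of the first partials is the joint distribution function of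
`S(t)` minus `1` (`sum_partialDeriv_lookbackPrice_self`). Its full mixed derivative is the density,
and the Asian basket formula is Fubini plus integration against the image measure.

The delicate point is the mixed derivative: each outer derivative needs the inner one at all nearby
points of a line, not just at almost all. This is `ae_hasDerivAt_cdf_last`: for a.e. value of the
last coordinate, the derivative in it exists for all values of the others at once. Lebesgue
differentiation gives this for the countably many rational corners, and monotonicity of the
increments in the corner squeezes the remaining ones. The derivative is again a distribution
function in one variable fewer, with the frozen coordinate added to the parameters, so
`ae_iteratedPartial_cdf` follows by induction.

For positive window length the price is convex along coordinate lines, so pointwise convergence of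
the prices forces convergence of the one-sided derivatives wherever the limit is differentiable. -/

/-! ### Differentiation of integrals depending on a parameter -/

/-- The derivative of a continuous function can be tested on rational increments. -/
theorem hasDerivAt_iff_forall_rat {H : ℝ → ℝ} (hH : Continuous H) (d s : ℝ) :
    HasDerivAt H d s ↔ ∀ k : ℕ, ∃ m : ℕ, ∀ q : ℚ, |(q : ℝ)| < 1 / (m + 1) →
      |H (s + q) - H s - q * d| ≤ 1 / (k + 1) * |(q : ℝ)| := by
  rw [hasDerivAt_iff_isLittleO_nhds_zero, Asymptotics.isLittleO_iff]
  simp only [smul_eq_mul, Real.norm_eq_abs]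
  constructor
  · intro h k
    obtain ⟨δ, hδ, hh⟩ := Metric.eventually_nhds_iff.1
      (h (c := 1 / ((k : ℝ) + 1)) Nat.one_div_pos_of_nat)
    obtain ⟨m, hm⟩ := exists_nat_one_div_lt hδ
    exact ⟨m, fun q hq => hh (by rw [Real.dist_eq, sub_zero]; exact hq.trans hm)⟩
  · intro h c hc
    obtain ⟨k, hk⟩ := exists_nat_one_div_lt hc
    obtain ⟨m, hm⟩ := h k
    have hcl : IsClosed {z : ℝ | |H (s + z) - H s - z * d| ≤ 1 / ((k : ℝ) + 1) * |z|} :=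
      isClosed_le (by fun_prop) (by fun_prop)
    have hsub : Metric.ball (0 : ℝ) (1 / ((m : ℝ) + 1)) ⊆
        {z : ℝ | |H (s + z) - H s - z * d| ≤ 1 / ((k : ℝ) + 1) * |z|} := by
      refine ((Rat.denseRange_cast (𝕜 := ℝ)).open_subset_closure_inter
        Metric.isOpen_ball).trans (closure_minimal ?_ hcl)
      rintro _ ⟨hz, q, rfl⟩
      exact hm q (by rwa [Metric.mem_ball, Real.dist_eq, sub_zero] at hz)
    filter_upwards [Metric.ball_mem_nhds (0 : ℝ) (Nat.one_div_pos_of_nat (n := m))] with z hz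
    exact (hsub hz).trans (mul_le_mul_of_nonneg_right hk.le (abs_nonneg z))

theorem continuous_setIntegral_Iic {g : ℝ → ℝ} (hg : Integrable g) :
    Continuous fun s => ∫ r in Iic s, g r := by
  have h : (fun s => ∫ r in Iic s, g r) =
      fun s => (∫ r in Iic (0 : ℝ), g r) + ∫ r in (0 : ℝ)..s, g r := by
    funext s
    rw [← intervalIntegral.integral_Iic_sub_Iic hg.integrableOn hg.integrableOn]
    ring
  rw [h]
  exact continuous_const.add (intervalIntegral.continuous_primitive
    (fun a b => hg.intervalIntegrable) 0)

theorem ae_hasDerivAt_setIntegral_Iic {g : ℝ → ℝ} (hg : Integrable g) :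
    ∀ᵐ s, HasDerivAt (fun s => ∫ r in Iic s, g r) (g s) s := by
  filter_upwards [LocallyIntegrable.ae_hasDerivAt_integral hg.locallyIntegrable] with s hs
  have h : (fun s => ∫ r in Iic s, g r) =
      fun s => (∫ r in Iic (0 : ℝ), g r) + ∫ r in (0 : ℝ)..s, g r := by
    funext s
    rw [← intervalIntegral.integral_Iic_sub_Iic hg.integrableOn hg.integrableOn]
    ring
  rw [h]
  exact (hs 0).const_add _

section Parameter

variable {α : Type*} [MeasurableSpace α] {ν : Measure α}

theorem measurable_setIntegral_Iic_param {g : α × ℝ → ℝ} (hg : Measurable g) :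
    Measurable fun p : α × ℝ => ∫ r in Iic p.2, g (p.1, r) := by
  have h : Measurable fun z : (α × ℝ) × ℝ =>
      ({z : (α × ℝ) × ℝ | z.2 ≤ z.1.2}.indicator fun z => g (z.1.1, z.2)) z :=
    (hg.comp (by fun_prop)).indicator (measurableSet_le (by fun_prop) (by fun_prop))
  have h2 := (h.stronglyMeasurable.integral_prod_right' (ν := (volume : Measure ℝ))).measurable
  convert h2 using 2 with p
  rw [← integral_indicator measurableSet_Iic]
  rfl

/-- The Lebesgue differentiation theorem with a parameter. -/
theorem ae_prod_hasDerivAt_setIntegral_Iic [SFinite ν] {g : α × ℝ → ℝ} (hg : Measurable g)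
    (hint : ∀ᵐ a ∂ν, Integrable fun r => g (a, r)) :
    ∀ᵐ p ∂ν.prod volume,
      HasDerivAt (fun s => ∫ r in Iic s, g (p.1, r)) (g p) p.2 := by
  set H : α × ℝ → ℝ := fun p => ∫ r in Iic p.2, g (p.1, r) with hHdef
  have hH : Measurable H := measurable_setIntegral_Iic_param hg
  -- Fubini for null sets needs a jointly measurable set; testing on rational increments makes this
  -- one a countable combination of measurable conditions.
  set E : Set (α × ℝ) := {p | ∀ k : ℕ, ∃ m : ℕ, ∀ q : ℚ, |(q : ℝ)| < 1 / (m + 1) →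
      |H (p.1, p.2 + q) - H p - q * g p| ≤ 1 / (k + 1) * |(q : ℝ)|} with hE
  have hEm : MeasurableSet E := by
    simp only [hE, Set.ofPred_forall, Set.ofPred_exists]
    refine MeasurableSet.iInter fun k => MeasurableSet.iUnion fun m =>
      MeasurableSet.iInter fun q => MeasurableSet.iInter fun _ => ?_
    refine measurableSet_le ?_ measurable_const
    have h1 : Measurable fun p : α × ℝ => H (p.1, p.2 + q) := hH.comp (by fun_prop)
    exact ((h1.sub hH).sub (hg.const_mul (q : ℝ))).norm
  have hint' : ∀ᵐ p ∂ν.prod (volume : Measure ℝ), Integrable fun r => g (p.1, r) :=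
    Measure.quasiMeasurePreserving_fst.ae hint
  have hE' : ∀ᵐ p ∂ν.prod (volume : Measure ℝ), p ∈ E := by
    rw [Measure.ae_prod_mem_iff_ae_ae_mem hEm]
    filter_upwards [hint] with a ha
    filter_upwards [ae_hasDerivAt_setIntegral_Iic ha] with s hs
    exact (hasDerivAt_iff_forall_rat (continuous_setIntegral_Iic ha) _ _).1 hs
  filter_upwards [hint', hE'] with p hp hpE
  exact (hasDerivAt_iff_forall_rat (continuous_setIntegral_Iic hp) _ _).2 hpE

end Parameter

/-- If the increments of `Φ x` are monotone in `x`, differentiability with derivative `g` passes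
from a set `D` to the points at which `g` can be approximated from both sides along `D`. -/
theorem hasDerivAt_of_monotone_increments {E : Type*} [Preorder E] {Φ : E → ℝ → ℝ} {g : E → ℝ}
    {s : ℝ} {D : Set E} (hΦ : ∀ x x', x ≤ x' → Monotone fun s => Φ x' s - Φ x s)
    (hD : ∀ x ∈ D, HasDerivAt (Φ x) (g x) s) {x : E}
    (hlow : ∀ c < g x, ∃ u ∈ D, u ≤ x ∧ c < g u) (hup : ∀ c > g x, ∃ v ∈ D, x ≤ v ∧ g v < c) :
    HasDerivAt (Φ x) (g x) s := by
  -- The difference quotients at `s` are monotone in `x`, so those of `Φ x` lie between those at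
  -- comparison points `u ≤ x ≤ v` of `D`.
  have hslope : ∀ x x', x ≤ x' → ∀ z, slope (Φ x) s z ≤ slope (Φ x') s z := by
    intro x x' hx z
    have h := hΦ x x' hx
    simp only [slope_def_field]
    rcases le_total s z with hz | hz
    · have := h hz
      exact div_le_div_of_nonneg_right (by simp only at this; linarith) (sub_nonneg.2 hz)
    · have := h hz
      exact div_le_div_of_nonpos_of_le (sub_nonpos.2 hz) (by simp only at this; linarith)
  rw [hasDerivAt_iff_tendsto_slope, tendsto_order]
  constructor
  · intro c hc
    obtain ⟨u, hu, hux, hcu⟩ := hlow c hc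
    filter_upwards [(tendsto_order.1 (hasDerivAt_iff_tendsto_slope.1 (hD u hu))).1 c hcu] with z hz
    exact hz.trans_le (hslope u x hux z)
  · intro c hc
    obtain ⟨v, hv, hxv, hcv⟩ := hup c hc
    filter_upwards [(tendsto_order.1 (hasDerivAt_iff_tendsto_slope.1 (hD v hv))).2 c hcv] with z hz
    exact (hslope x v hxv z).trans_lt hz

/-- Off the null hyperplanes `y i = x i`, membership of `y` in the orthant is locally constant in
its corner, so dominated convergence applies. -/
theorem continuous_setIntegral_Iic_pi {n : ℕ} {h : (Fin n → ℝ) → ℝ} (hh : Integrable h) :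
    Continuous fun x => ∫ y in Iic x, h y := by
  simp only [← integral_indicator measurableSet_Iic]
  refine continuous_iff_continuousAt.2 fun x => ?_
  refine continuousAt_of_dominated (bound := fun y => ‖h y‖)
    (Eventually.of_forall fun x' => (hh.indicator measurableSet_Iic).aestronglyMeasurable)
    (Eventually.of_forall fun x' => Eventually.of_forall fun y => norm_indicator_le_norm_self _ _)
    hh.norm ?_
  have hne : ∀ᵐ y : Fin n → ℝ, ∀ i, y i ≠ x i :=
    ae_all_iff.2 fun i => Measure.ae_eval_ne (fun _ : Fin n => (volume : Measure ℝ)) i (x i)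
  filter_upwards [hne] with y hy
  have hev : ∀ᶠ x' in 𝓝 x, (y ∈ Iic x' ↔ y ∈ Iic x) := by
    have h1 : ∀ᶠ x' in 𝓝 x, ∀ i, (y i ≤ x' i ↔ y i ≤ x i) := by
      refine eventually_all.2 fun i => ?_
      have hi : Tendsto (fun x' : Fin n → ℝ => x' i) (𝓝 x) (𝓝 (x i)) :=
        (continuous_apply i).continuousAt
      rcases lt_or_gt_of_ne (hy i) with hlt | hgt
      · filter_upwards [(tendsto_order.1 hi).1 _ hlt] with x' hx'
        exact iff_of_true hx'.le hlt.le
      · filter_upwards [(tendsto_order.1 hi).2 _ hgt] with x' hx'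
        exact iff_of_false hx'.not_ge hgt.not_ge
    filter_upwards [h1] with x' hx'
    simp only [mem_Iic, Pi.le_def, hx']
  refine (continuousAt_congr ?_).2 (continuousAt_const (y := (Iic x).indicator h y))
  filter_upwards [hev] with x' hx'
  by_cases hm : y ∈ Iic x
  · rw [indicator_of_mem (hx'.2 hm), indicator_of_mem hm]
  · rw [indicator_of_notMem (fun h => hm (hx'.1 h)), indicator_of_notMem hm]

theorem exists_rat_le_mem_of_mem_nhds {n : ℕ} {x : Fin n → ℝ} {U : Set (Fin n → ℝ)}
    (hU : U ∈ 𝓝 x) :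
    (∃ q : Fin n → ℚ, (fun i => (q i : ℝ)) ≤ x ∧ (fun i => (q i : ℝ)) ∈ U) ∧
      ∃ q : Fin n → ℚ, x ≤ (fun i => (q i : ℝ)) ∧ (fun i => (q i : ℝ)) ∈ U := by
  obtain ⟨ε, hε, hb⟩ := Metric.mem_nhds_iff.1 hU
  constructor
  · choose q hq using fun i => exists_rat_btwn (show x i - ε < x i by linarith)
    refine ⟨q, fun i => (hq i).2.le, hb ?_⟩
    rw [Metric.mem_ball, dist_pi_lt_iff hε]
    intro i
    rw [Real.dist_eq, abs_lt]
    constructor <;> linarith [(hq i).1, (hq i).2]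
  · choose q hq using fun i => exists_rat_btwn (show x i < x i + ε by linarith)
    refine ⟨q, fun i => (hq i).1.le, hb ?_⟩
    rw [Metric.mem_ball, dist_pi_lt_iff hε]
    intro i
    rw [Real.dist_eq, abs_lt]
    constructor <;> linarith [(hq i).1, (hq i).2]

/-! ### Mixed partial derivatives of multivariate distribution functions -/

/-- Append a last coordinate to a vector. -/
abbrev snocReal {n : ℕ} (x : Fin n → ℝ) (s : ℝ) : Fin (n + 1) → ℝ :=
  Fin.snoc (α := fun _ => ℝ) x s

theorem measurePreserving_snocReal (n : ℕ) :
    MeasurePreserving (fun p : ℝ × (Fin n → ℝ) => snocReal p.2 p.1) volume volume := by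
  have h : (fun p : ℝ × (Fin n → ℝ) => snocReal p.2 p.1) =
      (MeasurableEquiv.piFinSuccAbove (fun _ : Fin (n + 1) => ℝ) (Fin.last n)).symm := by
    funext p
    simp [MeasurableEquiv.piFinSuccAbove_symm_apply, Fin.insertNthEquiv, Fin.insertNth_last']
  rw [h]
  exact (volume_preserving_piFinSuccAbove (fun _ : Fin (n + 1) => ℝ) (Fin.last n)).symm

theorem measurableEmbedding_snocReal (n : ℕ) :
    MeasurableEmbedding (fun p : ℝ × (Fin n → ℝ) => snocReal p.2 p.1) := by
  have h := (MeasurableEquiv.piFinSuccAbove (fun _ : Fin (n + 1) => ℝ)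
    (Fin.last n)).symm.measurableEmbedding
  convert h using 1
  funext p
  simp [MeasurableEquiv.piFinSuccAbove_symm_apply, Fin.insertNthEquiv, Fin.insertNth_last']

theorem measurePreserving_last_init (n : ℕ) :
    MeasurePreserving (fun x : Fin (n + 1) → ℝ => (x (Fin.last n), fun j => x (Fin.castSucc j)))
      volume volume := by
  have h : (fun x : Fin (n + 1) → ℝ => (x (Fin.last n), fun j => x (Fin.castSucc j))) =
      MeasurableEquiv.piFinSuccAbove (fun _ : Fin (n + 1) => ℝ) (Fin.last n) := by
    funext x
    refine Prod.ext rfl (funext fun j => ?_)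
    simp [MeasurableEquiv.piFinSuccAbove, Fin.insertNthEquiv, Fin.init]
  rw [h]
  exact volume_preserving_piFinSuccAbove (fun _ : Fin (n + 1) => ℝ) (Fin.last n)

theorem snocReal_init_last {n : ℕ} (x : Fin (n + 1) → ℝ) :
    snocReal (fun j => x (Fin.castSucc j)) (x (Fin.last n)) = x :=
  Fin.snoc_init_self x

theorem preimage_snocReal_Iic {n : ℕ} (x : Fin n → ℝ) (s : ℝ) :
    (fun p : ℝ × (Fin n → ℝ) => snocReal p.2 p.1) ⁻¹' Iic (snocReal x s) = Iic s ×ˢ Iic x := by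
  ext p
  simp only [mem_preimage, mem_Iic, Pi.le_def, mem_prod, Fin.forall_fin_succ', snocReal,
    Fin.snoc_castSucc, Fin.snoc_last]
  exact and_comm

theorem setIntegral_Iic_snocReal {n : ℕ} {f : (Fin (n + 1) → ℝ) → ℝ} (hf : Integrable f)
    (x : Fin n → ℝ) (s : ℝ) :
    ∫ y in Iic (snocReal x s), f y = ∫ r in Iic s, ∫ y in Iic x, f (snocReal y r) := by
  rw [← (measurePreserving_snocReal n).setIntegral_preimage_emb (measurableEmbedding_snocReal n),
    preimage_snocReal_Iic]
  exact setIntegral_prod _ ((measurePreserving_snocReal n).integrable_comp_of_integrable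
    hf).integrableOn

/-- The last entry of the list is the derivative taken first; peeling it off drives the induction on
the dimension. -/
theorem iteratedPartial_concat {n : ℕ} (l : List (Fin n)) (i : Fin n) (f : (Fin n → ℝ) → ℝ) :
    iteratedPartial (l ++ [i]) f = iteratedPartial l (partialDeriv i f) := by
  induction l with
  | nil => rfl
  | cons j l ih => simp only [List.cons_append, iteratedPartial, ih]

theorem iteratedPartial_map_castSucc {n : ℕ} (l : List (Fin n)) (f : (Fin (n + 1) → ℝ) → ℝ)
    (s : ℝ) (x : Fin n → ℝ) :
    iteratedPartial (l.map Fin.castSucc) f (snocReal x s) =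
      iteratedPartial l (fun y => f (snocReal y s)) x := by
  induction l generalizing x with
  | nil => rfl
  | cons j l ih =>
    simp only [List.map_cons, iteratedPartial, partialDeriv, snocReal, Fin.snoc_castSucc,
      ← Fin.snoc_update]
    simp only [snocReal] at ih
    simp only [ih]

/-- The outer derivatives move only within the slice where the last coordinate is `s`, so it
suffices that the innermost derivative exists on that whole slice. -/
theorem iteratedPartialExists_map_castSucc_concat {n : ℕ} (l : List (Fin n))
    (f : (Fin (n + 1) → ℝ) → ℝ) (s : ℝ)
    (hf : ∀ x : Fin n → ℝ, PartialExists (Fin.last n) f (snocReal x s)) (x : Fin n → ℝ)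
    (h : IteratedPartialExists l (fun y => partialDeriv (Fin.last n) f (snocReal y s)) x) :
    IteratedPartialExists (l.map Fin.castSucc ++ [Fin.last n]) f (snocReal x s) := by
  induction l generalizing x with
  | nil => exact ⟨Eventually.of_forall fun _ => trivial, hf x⟩
  | cons j l ih =>
    obtain ⟨h1, h2⟩ := h
    simp only [List.map_cons, List.cons_append]
    refine ⟨?_, ?_⟩
    · simp only [snocReal, Fin.snoc_castSucc, ← Fin.snoc_update]
      exact h1.mono fun y hy => ih _ hy
    · rw [iteratedPartial_concat]
      have := iteratedPartial_map_castSucc l (partialDeriv (Fin.last n) f) s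
      simp only [PartialExists, snocReal, Fin.snoc_castSucc, ← Fin.snoc_update] at this h2 ⊢
      simp only [this]
      exact h2

/-- For almost every value of the last coordinate (and of the parameter), the distribution function
with density `f a` is differentiable in the last coordinate, whatever the other coordinates are. -/
theorem ae_hasDerivAt_cdf_last {α : Type*} [MeasurableSpace α] {ν : Measure α} [SFinite ν] {n : ℕ}
    {f : α × (Fin (n + 1) → ℝ) → ℝ} (hf : Measurable f) (h0 : 0 ≤ f)
    (hint : ∀ᵐ a ∂ν, Integrable fun y => f (a, y)) :
    ∀ᵐ p ∂ν.prod (volume : Measure ℝ), (Integrable fun y => f (p.1, snocReal y p.2)) ∧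
      ∀ x : Fin n → ℝ, HasDerivAt (fun s => ∫ y in Iic (snocReal x s), f (p.1, y))
        (∫ y in Iic x, f (p.1, snocReal y p.2)) p.2 := by
  have hcomp : ∀ a, (Integrable fun y => f (a, y)) →
      Integrable (fun z : ℝ × (Fin n → ℝ) => f (a, snocReal z.2 z.1))
        ((volume : Measure ℝ).prod volume) := fun a ha =>
    (measurePreserving_snocReal n).integrable_comp_of_integrable ha
  have hf' : Measurable fun z : (α × ℝ) × (Fin n → ℝ) => f (z.1.1, snocReal z.2 z.1.2) := by
    refine hf.comp (measurable_fst.fst.prodMk ?_)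
    exact (measurePreserving_snocReal n).measurable.comp
      (measurable_fst.snd.prodMk measurable_snd)
  have hint' : ∀ᵐ p ∂ν.prod (volume : Measure ℝ), Integrable fun y : Fin n → ℝ =>
      f (p.1, snocReal y p.2) := by
    have hm : MeasurableSet {p : α × ℝ | Integrable fun y : Fin n → ℝ =>
        f (p.1, snocReal y p.2)} := measurableSet_integrable hf'.stronglyMeasurable
    refine (Measure.ae_prod_mem_iff_ae_ae_mem hm).2 ?_
    filter_upwards [hint] with a ha
    exact (hcomp a ha).prod_right_ae
  have hrat : ∀ᵐ p ∂ν.prod (volume : Measure ℝ), ∀ q : Fin n → ℚ,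
      HasDerivAt (fun s => ∫ r in Iic s, ∫ y in Iic (fun i => (q i : ℝ)), f (p.1, snocReal y r))
        (∫ y in Iic (fun i => (q i : ℝ)), f (p.1, snocReal y p.2)) p.2 := by
    refine ae_all_iff.2 fun q => ?_
    refine ae_prod_hasDerivAt_setIntegral_Iic (g := fun p : α × ℝ =>
      ∫ y in Iic (fun i => (q i : ℝ)), f (p.1, snocReal y p.2))
      (hf'.stronglyMeasurable.integral_prod_right'
        (ν := volume.restrict (Iic fun i => (q i : ℝ)))).measurable ?_
    filter_upwards [hint] with a ha
    have := (hcomp a ha).restrict (s := univ ×ˢ Iic fun i => (q i : ℝ))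
    rw [← Measure.prod_restrict, Measure.restrict_univ] at this
    exact this.integral_prod_left
  have hinta : ∀ᵐ p ∂ν.prod (volume : Measure ℝ), Integrable fun y => f (p.1, y) :=
    Measure.quasiMeasurePreserving_fst.ae hint
  filter_upwards [hint', hrat, hinta] with p hp hq ha
  refine ⟨hp, fun x => ?_⟩
  have hcont := continuous_setIntegral_Iic_pi hp
  refine hasDerivAt_of_monotone_increments
    (Φ := fun (x : Fin n → ℝ) s => ∫ y in Iic (snocReal x s), f (p.1, y))
    (g := fun x : Fin n → ℝ => ∫ y in Iic x, f (p.1, snocReal y p.2))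
    (D := range fun (q : Fin n → ℚ) i => (q i : ℝ)) ?_ ?_ ?_ ?_
  -- The increment from corner `x` to `x'` is the integral of a nonnegative function over a
  -- difference of orthants. This region grows with `s`: a point in it violates a bound on the first
  -- `n` coordinates, which raising `s` does not relax.
  · intro x x' hx s s' hs
    have hsub : ∀ s, Iic (snocReal x s) ⊆ Iic (snocReal x' s) := fun s => by
      refine Iic_subset_Iic.2 ?_
      simpa [Pi.le_def, Fin.forall_fin_succ'] using hx
    have hdiff : ∀ s, (∫ y in Iic (snocReal x' s), f (p.1, y)) -
        (∫ y in Iic (snocReal x s), f (p.1, y)) =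
        ∫ y in Iic (snocReal x' s) \ Iic (snocReal x s), f (p.1, y) := fun s =>
      (setIntegral_sdiff measurableSet_Iic ha.integrableOn (hsub s)).symm
    simp only [hdiff]
    refine setIntegral_mono_set ha.integrableOn (Eventually.of_forall fun y => h0 _)
      (LE.le.eventuallyLE ?_)
    intro y hy
    simp only [Set.mem_sdiff, mem_Iic, Pi.le_def, Fin.forall_fin_succ', snocReal,
      Fin.snoc_castSucc, Fin.snoc_last, not_and, not_le] at hy ⊢
    exact ⟨⟨hy.1.1, hy.1.2.trans hs⟩, fun h => absurd hy.1.2 (hy.2 h).not_ge⟩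
  · rintro _ ⟨q, rfl⟩
    simpa only [setIntegral_Iic_snocReal ha] using hq q
  · intro c hc
    obtain ⟨⟨q, hqx, hqU⟩, -⟩ := exists_rat_le_mem_of_mem_nhds
      (hcont.continuousAt.eventually (lt_mem_nhds hc))
    exact ⟨_, ⟨q, rfl⟩, hqx, hqU⟩
  · intro c hc
    obtain ⟨-, ⟨q, hqx, hqU⟩⟩ := exists_rat_le_mem_of_mem_nhds
      (hcont.continuousAt.eventually (gt_mem_nhds hc))
    exact ⟨_, ⟨q, rfl⟩, hqx, hqU⟩

/-- The full mixed derivative of a distribution function (depending on a parameter `a`, and up to an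
additive constant) exists almost everywhere and is the density. -/
theorem ae_iteratedPartial_cdf (n : ℕ) {α : Type*} [MeasurableSpace α] (ν : Measure α) [SFinite ν]
    (f : α × (Fin n → ℝ) → ℝ) (hf : Measurable f) (h0 : 0 ≤ f)
    (hint : ∀ᵐ a ∂ν, Integrable fun y => f (a, y)) (H : α → (Fin n → ℝ) → ℝ) (c : ℝ)
    (hc : n = 0 → c = 0) (hH : ∀ᵐ a ∂ν, ∀ x, H a x = (∫ y in Iic x, f (a, y)) + c) :
    ∀ᵐ p ∂ν.prod volume, IteratedPartialExists (List.finRange n) (H p.1) p.2 ∧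
      iteratedPartial (List.finRange n) (H p.1) p.2 = f p := by
  induction n generalizing α c with
  | zero =>
    filter_upwards [Measure.quasiMeasurePreserving_fst.ae hH] with p hp
    refine ⟨by simp [IteratedPartialExists], ?_⟩
    -- In dimension zero Lebesgue measure is a Dirac mass and no derivative is left to remove `c`,
    -- hence the condition `n = 0 → c = 0`.
    have huniv : Iic p.2 = univ := eq_univ_of_forall fun y => by simp [Subsingleton.elim y p.2]
    have hpi : (volume : Measure (Fin 0 → ℝ)) = Measure.dirac p.2 := by
      rw [volume_pi, Measure.pi_of_empty _ p.2]
    simp only [List.finRange_zero, iteratedPartial, hp, hc rfl, add_zero, huniv,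
      Measure.restrict_univ]
    rw [hpi, integral_dirac]
  | succ n ih =>
    have hlast := ae_hasDerivAt_cdf_last hf h0 hint
    have hH' : ∀ᵐ p ∂ν.prod (volume : Measure ℝ), ∀ x, H p.1 x = (∫ y in Iic x, f (p.1, y)) + c :=
      Measure.quasiMeasurePreserving_fst.ae hH
    have hderiv : ∀ᵐ p ∂ν.prod (volume : Measure ℝ), ∀ x : Fin n → ℝ,
        HasDerivAt (fun s => H p.1 (Function.update (snocReal x p.2) (Fin.last n) s))
          (∫ y in Iic x, f (p.1, snocReal y p.2)) p.2 := by
      filter_upwards [hlast, hH'] with p hp hpH x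
      simp only [snocReal, Fin.update_snoc_last, hpH]
      exact (hp.2 x).add_const c
    -- The last coordinate joins the parameter, and the additive constant has been differentiated
    -- away, so the induction continues with constant `0`.
    have hmain := ih (ν.prod (volume : Measure ℝ))
      (fun z => f (z.1.1, snocReal z.2 z.1.2))
      (hf.comp (measurable_fst.fst.prodMk ((measurePreserving_snocReal n).measurable.comp
        (measurable_fst.snd.prodMk measurable_snd))))
      (fun z => h0 _) (hlast.mono fun p hp => hp.1)
      (fun p x => partialDeriv (Fin.last n) (H p.1) (snocReal x p.2)) 0 (fun _ => rfl)
      (by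
        filter_upwards [hderiv] with p hp x
        rw [add_zero, ← (hp x).deriv]
        simp only [partialDeriv, snocReal, Fin.snoc_last])
    have hφ : MeasurePreserving (fun z : α × (Fin (n + 1) → ℝ) =>
        ((z.1, z.2 (Fin.last n)), fun j : Fin n => z.2 (Fin.castSucc j)))
        (ν.prod volume) ((ν.prod volume).prod volume) :=
      ((measurePreserving_prodAssoc ν (volume : Measure ℝ)
        (volume : Measure (Fin n → ℝ))).symm).comp
        ((MeasurePreserving.id ν).prod (measurePreserving_last_init n))
    have hderiv' : ∀ᵐ z ∂(ν.prod (volume : Measure ℝ)).prod (volume : Measure (Fin n → ℝ)),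
        ∀ x : Fin n → ℝ,
        HasDerivAt (fun s => H z.1.1 (Function.update (snocReal x z.1.2) (Fin.last n) s))
          (∫ y in Iic x, f (z.1.1, snocReal y z.1.2)) z.1.2 :=
      Measure.quasiMeasurePreserving_fst.ae hderiv
    filter_upwards [hφ.quasiMeasurePreserving.ae hmain, hφ.quasiMeasurePreserving.ae hderiv']
      with z hz hzd
    simp only [snocReal_init_last] at hz
    rw [List.finRange_succ_last]
    constructor
    · rw [← snocReal_init_last z.2]
      refine iteratedPartialExists_map_castSucc_concat _ _ _ (fun x => ?_) _ hz.1
      have := (hzd x).differentiableAt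
      simpa only [PartialExists, snocReal, Fin.snoc_last] using this
    · rw [iteratedPartial_concat]
      conv_lhs => rw [← snocReal_init_last z.2]
      rw [iteratedPartial_map_castSucc]
      exact hz.2

/-! ### Limits of one-sided derivatives of convex functions -/

/-- If convex functions converge pointwise to a function differentiable at `y`, their one-sided
derivatives at `y` converge to its derivative. -/
theorem tendsto_derivWithin_of_convexOn {ι : Type*} {l : Filter ι} {φ : ι → ℝ → ℝ} {ψ : ℝ → ℝ}
    {y d : ℝ} (hconv : ∀ᶠ s in l, ConvexOn ℝ univ (φ s))
    (hlim : ∀ z, Tendsto (fun s => φ s z) l (𝓝 (ψ z))) (hψ : HasDerivAt ψ d y) :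
    Tendsto (fun s => derivWithin (φ s) (Ioi y) y) l (𝓝 d) ∧
      Tendsto (fun s => derivWithin (φ s) (Iio y) y) l (𝓝 d) := by
  have hint : y ∈ interior (univ : Set ℝ) := by simp
  have hslope : ∀ z, Tendsto (fun s => slope (φ s) y z) l (𝓝 (slope ψ y z)) := fun z => by
    simp only [slope_def_field]
    exact ((hlim z).sub (hlim y)).div_const _
  have hψ' := hasDerivAt_iff_tendsto_slope.1 hψ
  -- Fix one secant of `ψ` to the right of `y` with slope below `c`: the corresponding secants of `φ
  -- s` converge to it and bound the right derivatives from above. The left side is symmetric, and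
  -- left derivative ≤ right derivative supplies the two missing bounds.
  have hup : ∀ c > d, ∀ᶠ s in l, derivWithin (φ s) (Ioi y) y < c := by
    intro c hc
    have h1 : ∀ᶠ z in 𝓝[>] y, slope ψ y z < c :=
      (hψ'.mono_left (nhdsWithin_mono y fun z hz => ne_of_gt hz)).eventually (gt_mem_nhds hc)
    obtain ⟨z, hz, hyz⟩ := (h1.and self_mem_nhdsWithin).exists
    filter_upwards [hconv, (hslope z).eventually (gt_mem_nhds hz)] with s hs hsz
    exact (hs.rightDeriv_le_slope_of_mem_interior hint (mem_univ z) hyz).trans_lt hsz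
  have hlow : ∀ c < d, ∀ᶠ s in l, c < derivWithin (φ s) (Iio y) y := by
    intro c hc
    have h1 : ∀ᶠ z in 𝓝[<] y, c < slope ψ y z :=
      (hψ'.mono_left (nhdsWithin_mono y fun z hz => ne_of_lt hz)).eventually (lt_mem_nhds hc)
    obtain ⟨z, hz, hyz⟩ := (h1.and self_mem_nhdsWithin).exists
    filter_upwards [hconv, (hslope z).eventually (lt_mem_nhds hz)] with s hs hsz
    refine hsz.trans_le ?_
    rw [slope_comm]
    exact hs.slope_le_leftDeriv_of_mem_interior (mem_univ z) hint hyz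
  constructor
  · refine tendsto_order.2 ⟨fun c hc => ?_, hup⟩
    filter_upwards [hconv, hlow c hc] with s hs h
    exact h.trans_le (hs.leftDeriv_le_rightDeriv_of_mem_interior hint)
  · refine tendsto_order.2 ⟨hlow, fun c hc => ?_⟩
    filter_upwards [hconv, hup c hc] with s hs h
    exact (hs.leftDeriv_le_rightDeriv_of_mem_interior hint).trans_lt h

/-! ### The look-back payoff along a path -/

section Path

variable {Ω : Type*} {n : ℕ} {S : Fin n → ℝ → Ω → ℝ} {T t₀ t₁ : ℝ} {ω : Ω}

/-- Characterising the upper bounds of the payoff replaces all manipulation of nested suprema below.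
Boundedness and nonemptiness are essential because a real `⨆` otherwise takes the default value `0`.
-/
theorem iSup_max_sub_le_iff [NeZero n] {A : Set ℝ} [Nonempty A]
    (hb : ∀ i, BddAbove (range fun u : A => S i u ω)) (x : Fin n → ℝ) (c : ℝ) :
    (⨆ i, ⨆ u : A, max (S i u ω - x i) 0) ≤ c ↔ 0 ≤ c ∧ ∀ i, ∀ u ∈ A, S i u ω - x i ≤ c := by
  have hb' : ∀ i, BddAbove (range fun u : A => max (S i u ω - x i) 0) := by
    intro i
    obtain ⟨M, hM⟩ := hb i
    refine ⟨max (M - x i) 0, ?_⟩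
    rintro _ ⟨u, rfl⟩
    exact max_le_max_right 0 (sub_le_sub_right (hM ⟨u, rfl⟩) _)
  rw [ciSup_le_iff (finite_range _).bddAbove]
  refine (forall_congr' fun i => ciSup_le_iff (hb' i)).trans ?_
  simp only [max_le_iff, Subtype.forall]
  constructor
  · intro h
    obtain ⟨u⟩ := (inferInstance : Nonempty A)
    exact ⟨(h 0 u u.2).2, fun i u hu => (h i u hu).1⟩
  · exact fun h i u hu => ⟨h.2 i u hu, h.1⟩

theorem bddAbove_range_Icc (h₀ : 0 ≤ t₀) (h₁ : t₁ ≤ T) {A : Set ℝ} (hA : A ⊆ Icc t₀ t₁)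
    {g : ℝ → ℝ} (hb : BddAbove (range fun u : Icc (0 : ℝ) T => g u)) :
    BddAbove (range fun u : A => g u) := by
  refine hb.mono ?_
  rintro _ ⟨u, rfl⟩
  exact ⟨⟨u, h₀.trans (hA u.2).1, (hA u.2).2.trans h₁⟩, rfl⟩

theorem lookbackPayoff_le_iff [NeZero n] (h₀ : 0 ≤ t₀) (h₀₁ : t₀ ≤ t₁) (h₁ : t₁ ≤ T)
    (hb : ∀ i, BddAbove (range fun u : Icc (0 : ℝ) T => S i u ω)) (x : Fin n → ℝ) (c : ℝ) :
    lookbackPayoff S t₀ t₁ x ω ≤ c ↔ 0 ≤ c ∧ ∀ i, ∀ u ∈ Icc t₀ t₁, S i u ω - x i ≤ c :=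
  have : Nonempty (Icc t₀ t₁) := ⟨⟨t₀, le_rfl, h₀₁⟩⟩
  iSup_max_sub_le_iff
    (fun i => bddAbove_range_Icc (g := fun u => S i u ω) h₀ h₁ subset_rfl (hb i)) x c

theorem lookbackPayoff_self_le_iff [NeZero n] {t : ℝ} (ht : t ∈ Icc 0 T)
    (hb : ∀ i, BddAbove (range fun u : Icc (0 : ℝ) T => S i u ω)) (x : Fin n → ℝ) (c : ℝ) :
    lookbackPayoff S t t x ω ≤ c ↔ 0 ≤ c ∧ ∀ i, S i t ω - x i ≤ c := by
  rw [lookbackPayoff_le_iff ht.1 le_rfl ht.2 hb]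
  simp

theorem lookbackPayoff_sub_le [NeZero n] (h₀ : 0 ≤ t₀) (h₀₁ : t₀ ≤ t₁) (h₁ : t₁ ≤ T)
    (hb : ∀ i, BddAbove (range fun u : Icc (0 : ℝ) T => S i u ω)) (x x' : Fin n → ℝ) :
    |lookbackPayoff S t₀ t₁ x ω - lookbackPayoff S t₀ t₁ x' ω| ≤ dist x x' := by
  have key : ∀ x x' : Fin n → ℝ,
      lookbackPayoff S t₀ t₁ x ω ≤ lookbackPayoff S t₀ t₁ x' ω + dist x x' := by
    intro x x'
    obtain ⟨h1, h2⟩ := (lookbackPayoff_le_iff h₀ h₀₁ h₁ hb x' _).1 le_rfl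
    refine (lookbackPayoff_le_iff h₀ h₀₁ h₁ hb x _).2 ⟨by positivity, fun i u hu => ?_⟩
    have h3 := h2 i u hu
    have h4 := (abs_le.1 ((Real.dist_eq _ _).symm.trans_le (dist_le_pi_dist x x' i))).1
    linarith
  rw [abs_le]
  constructor
  · linarith [key x' x, dist_comm x x']
  · linarith [key x x']

theorem convexOn_lookbackPayoff [NeZero n] (h₀ : 0 ≤ t₀) (h₀₁ : t₀ ≤ t₁) (h₁ : t₁ ≤ T)
    (hb : ∀ i, BddAbove (range fun u : Icc (0 : ℝ) T => S i u ω)) :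
    ConvexOn ℝ univ fun x => lookbackPayoff S t₀ t₁ x ω := by
  refine ⟨convex_univ, fun x _ x' _ a b ha hb' hab => ?_⟩
  obtain ⟨h1, h2⟩ := (lookbackPayoff_le_iff h₀ h₀₁ h₁ hb x _).1 le_rfl
  obtain ⟨h1', h2'⟩ := (lookbackPayoff_le_iff h₀ h₀₁ h₁ hb x' _).1 le_rfl
  simp only [smul_eq_mul]
  refine (lookbackPayoff_le_iff h₀ h₀₁ h₁ hb _ _).2 ⟨by positivity, fun i u hu => ?_⟩
  have h3 := mul_le_mul_of_nonneg_left (h2 i u hu) ha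
  have h4 := mul_le_mul_of_nonneg_left (h2' i u hu) hb'
  simp only [Pi.add_apply, Pi.smul_apply, smul_eq_mul]
  have h5 : S i u ω = a * S i u ω + b * S i u ω := by rw [← add_mul, hab, one_mul]
  linarith

/-- A countable set of times over which a right-continuous path has the same supremum as over
`[t₀, t₁]`. -/
def lookbackTimes (t₀ t₁ : ℝ) : Set ℝ := insert t₁ (range ((↑) : ℚ → ℝ) ∩ Icc t₀ t₁)

theorem countable_lookbackTimes (t₀ t₁ : ℝ) : (lookbackTimes t₀ t₁).Countable :=
  ((countable_range _).mono inter_subset_left).insert t₁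

theorem lookbackTimes_subset (h₀₁ : t₀ ≤ t₁) : lookbackTimes t₀ t₁ ⊆ Icc t₀ t₁ :=
  insert_subset ⟨h₀₁, le_rfl⟩ inter_subset_right

/-- A countable supremum is measurable, which the supremum over the window need not visibly be. A
value exceeding a bound at `u < t₁` still does so at rational times just to the right; the endpoint
`t₁` has no such times in the window and is added by hand. -/
theorem lookbackPayoff_eq_iSup_lookbackTimes [NeZero n] (h₀ : 0 ≤ t₀) (h₀₁ : t₀ ≤ t₁)
    (h₁ : t₁ ≤ T) (hb : ∀ i, BddAbove (range fun u : Icc (0 : ℝ) T => S i u ω))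
    (hrc : ∀ i, ∀ t ∈ Ico 0 T, ContinuousWithinAt (fun u => S i u ω) (Ici t) t)
    (x : Fin n → ℝ) :
    lookbackPayoff S t₀ t₁ x ω = ⨆ i, ⨆ u : lookbackTimes t₀ t₁, max (S i u ω - x i) 0 := by
  have : Nonempty (lookbackTimes t₀ t₁) := ⟨⟨t₁, mem_insert _ _⟩⟩
  refine eq_of_forall_ge_iff fun c => ?_
  rw [lookbackPayoff_le_iff h₀ h₀₁ h₁ hb, iSup_max_sub_le_iff
    (fun i => bddAbove_range_Icc (g := fun u => S i u ω) h₀ h₁ (lookbackTimes_subset h₀₁) (hb i))]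
  refine and_congr_right fun _ => ⟨fun h i u hu => h i u (lookbackTimes_subset h₀₁ hu),
    fun h i u hu => ?_⟩
  rcases hu.2.eq_or_lt with rfl | hlt
  · exact h i u (mem_insert _ _)
  by_contra! hc
  have hev : ∀ᶠ v in 𝓝[≥] u, c + x i < S i v ω :=
    (hrc i u ⟨h₀.trans hu.1, hlt.trans_le h₁⟩).tendsto.eventually
      (lt_mem_nhds (by linarith))
  obtain ⟨w, hw, hsub⟩ := (mem_nhdsGE_iff_exists_Ico_subset' hlt).1 hev
  obtain ⟨q, hq, hq'⟩ := exists_rat_btwn (lt_min hlt hw)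
  have h3 := h i q (mem_insert_of_mem _
    ⟨⟨q, rfl⟩, hu.1.trans hq.le, hq'.le.trans (min_le_left _ _)⟩)
  have h4 : c + x i < S i q ω := hsub ⟨hq.le, hq'.trans_le (min_le_right _ _)⟩
  linarith

theorem tendsto_lookbackPayoff [NeZero n] {t : ℝ} (ht : t ∈ Ico 0 T)
    (hb : ∀ i, BddAbove (range fun u : Icc (0 : ℝ) T => S i u ω))
    (hrc : ∀ i, ∀ t ∈ Ico 0 T, ContinuousWithinAt (fun u => S i u ω) (Ici t) t)
    (x : Fin n → ℝ) :
    Tendsto (fun s => lookbackPayoff S t (t + s) x ω) (𝓝[>] 0)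
      (𝓝 (lookbackPayoff S t t x ω)) := by
  have ht' : t ∈ Icc 0 T := ⟨ht.1, ht.2.le⟩
  obtain ⟨h1, h2⟩ := (lookbackPayoff_self_le_iff ht' hb x _).1 le_rfl
  have hsmall : ∀ᶠ s in 𝓝[>] (0 : ℝ), 0 < s ∧ s < T - t := by
    filter_upwards [Ioo_mem_nhdsGT (sub_pos.2 ht.2)] with s hs using hs
  refine tendsto_order.2 ⟨fun c hc => ?_, fun c hc => ?_⟩
  · filter_upwards [hsmall] with s hs
    refine hc.trans_le ((lookbackPayoff_self_le_iff ht' hb x _).2 ?_)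
    obtain ⟨h3, h4⟩ := (lookbackPayoff_le_iff ht.1 (by linarith) (by linarith : t + s ≤ T)
      hb x _).1 le_rfl
    exact ⟨h3, fun i => h4 i t ⟨le_rfl, by linarith⟩⟩
  -- Strict bounds at each time of the window give only a weak bound on the supremum, so some room
  -- is left between `c'` and `c`.
  · obtain ⟨c', hc', hcc'⟩ := exists_between hc
    have hev : ∀ᶠ v in 𝓝[≥] t, ∀ i, S i v ω < c' + x i :=
      eventually_all.2 fun i => (hrc i t ht).tendsto.eventually
        (gt_mem_nhds (by linarith [h2 i]))
    obtain ⟨w, hw, hsub⟩ := (mem_nhdsGE_iff_exists_Ico_subset' ht.2).1 hev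
    filter_upwards [hsmall, Ioo_mem_nhdsGT (sub_pos.2 hw)] with s hs hsw
    refine lt_of_le_of_lt ((lookbackPayoff_le_iff ht.1 (by linarith) (by linarith : t + s ≤ T)
      hb x c').2 ⟨h1.trans hc'.le, fun i u hu => ?_⟩) hcc'
    have : S i u ω < c' + x i := hsub ⟨hu.1, by linarith [hu.2, hsw.2]⟩ i
    linarith

theorem abs_lookbackPayoff_le [NeZero n] (h₀ : 0 ≤ t₀) (h₀₁ : t₀ ≤ t₁) (h₁ : t₁ ≤ T)
    (hb : ∀ i, BddAbove (range fun u : Icc (0 : ℝ) T => S i u ω)) (x : Fin n → ℝ) :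
    |lookbackPayoff S t₀ t₁ x ω| ≤ ∑ i, (|⨆ u : Icc (0 : ℝ) T, S i u ω| + |x i|) := by
  have h := ((lookbackPayoff_le_iff h₀ h₀₁ h₁ hb x _).1 le_rfl).1
  rw [abs_of_nonneg h]
  refine (lookbackPayoff_le_iff h₀ h₀₁ h₁ hb x _).2 ⟨by positivity, fun i u hu => ?_⟩
  have h1 : S i u ω ≤ ⨆ u : Icc (0 : ℝ) T, S i u ω :=
    le_ciSup (hb i) ⟨u, h₀.trans hu.1, hu.2.trans h₁⟩
  refine le_trans ?_ (Finset.single_le_sum (f := fun i => |⨆ u : Icc (0 : ℝ) T, S i u ω| + |x i|)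
    (fun i _ => by positivity) (Finset.mem_univ i))
  linarith [le_abs_self (⨆ u : Icc (0 : ℝ) T, S i u ω), neg_abs_le (x i)]

/-- Slope in the `i`-th strike `x_i` of the payoff `max_j (S_j - x_j)^+`, where `z_j = S_j - x_j`:
`-1` if asset `i` is in the money and strictly best, and `0` otherwise. -/
noncomputable def bestAssetSlope (z : Fin n → ℝ) (i : Fin n) : ℝ :=
  open Classical in if 0 < z i ∧ ∀ j, j ≠ i → z j < z i then -1 else 0

/-- Near `x i` the payoff is either `S i t ω - y`, when asset `i` is strictly best and in the money,
or constant: without ties and zeros, asset `i` otherwise stays strictly below the payoff and a small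
change of its strike is not seen. -/
theorem hasDerivAt_lookbackPayoff_self [NeZero n] {t : ℝ} (ht : t ∈ Icc 0 T)
    (hb : ∀ i, BddAbove (range fun u : Icc (0 : ℝ) T => S i u ω)) (x : Fin n → ℝ)
    (h0 : ∀ i, S i t ω - x i ≠ 0) (hinj : ∀ i j, i ≠ j → S i t ω - x i ≠ S j t ω - x j)
    (i : Fin n) :
    HasDerivAt (fun y => lookbackPayoff S t t (Function.update x i y) ω)
      (bestAssetSlope (fun j => S j t ω - x j) i) (x i) := by
  have hle := fun x c => lookbackPayoff_self_le_iff (S := S) (ω := ω) ht hb x c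
  have hcont : Tendsto (fun y => S i t ω - y) (𝓝 (x i)) (𝓝 (S i t ω - x i)) :=
    (continuous_const.sub continuous_id).continuousAt
  unfold bestAssetSlope
  split_ifs with hbest
  · have hev : ∀ᶠ y in 𝓝 (x i), 0 < S i t ω - y ∧ ∀ j, j ≠ i → S j t ω - x j < S i t ω - y :=
      (hcont.eventually (lt_mem_nhds hbest.1)).and (eventually_all.2 fun j => by
        by_cases hj : j = i
        · simp [hj]
        · exact (hcont.eventually (lt_mem_nhds (hbest.2 j hj))).mono fun y hy _ => hy)
    have heq : (fun y => lookbackPayoff S t t (Function.update x i y) ω) =ᶠ[𝓝 (x i)]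
        fun y => S i t ω - y := by
      filter_upwards [hev] with y hy
      refine le_antisymm ((hle _ _).2 ⟨hy.1.le, fun j => ?_⟩) ?_
      · by_cases hj : j = i
        · simp [hj]
        · simpa [hj] using (hy.2 j hj).le
      · simpa using ((hle (Function.update x i y) _).1 le_rfl).2 i
    exact ((hasDerivAt_id (x i)).const_sub _).congr_of_eventuallyEq heq
  · obtain ⟨hP0, hP⟩ := (hle x _).1 le_rfl
    have hlt : S i t ω - x i < lookbackPayoff S t t x ω := by
      by_cases hpos : 0 < S i t ω - x i
      · push Not at hbest
        obtain ⟨j, hji, hj⟩ := hbest hpos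
        exact (lt_of_le_of_ne hj (hinj i j hji.symm)).trans_le (hP j)
      · exact (lt_of_le_of_ne (not_lt.1 hpos) (h0 i)).trans_le hP0
    have heq : (fun y => lookbackPayoff S t t (Function.update x i y) ω) =ᶠ[𝓝 (x i)]
        fun _ => lookbackPayoff S t t x ω := by
      filter_upwards [hcont.eventually (gt_mem_nhds hlt)] with y hy
      refine le_antisymm ((hle _ _).2 ⟨hP0, fun j => ?_⟩) ?_
      · by_cases hj : j = i
        · subst hj
          simpa using hy.le
        · simpa [hj] using hP j
      · obtain ⟨h1, h2⟩ := (hle (Function.update x i y) _).1 le_rfl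
        -- Only asset `i` is affected by the change of strike, and its own contribution is strictly
        -- below the payoff, so the first term attains the maximum.
        have h3 : lookbackPayoff S t t x ω ≤
            max (lookbackPayoff S t t (Function.update x i y) ω) (S i t ω - x i) := by
          refine (hle _ _).2 ⟨le_max_of_le_left h1, fun j => ?_⟩
          by_cases hj : j = i
          · rw [hj]
            exact le_max_right _ _
          · exact le_max_of_le_left (by simpa [hj] using h2 j)
        exact (le_max_iff.1 h3).resolve_right hlt.not_ge
    exact (hasDerivAt_const (x i) _).congr_of_eventuallyEq heq

/-- If some entry is positive, the maximal entry is positive and unique, and it alone contributes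
`-1`. -/
theorem sum_bestAssetSlope (z : Fin n → ℝ) (hinj : ∀ i j, i ≠ j → z i ≠ z j) :
    ∑ i, bestAssetSlope z i = open Classical in (if ∀ i, z i ≤ 0 then (1 : ℝ) else 0) - 1 := by
  split_ifs with h
  · rw [sub_self]
    refine Finset.sum_eq_zero fun i _ => if_neg fun hi => hi.1.not_ge (h i)
  · push Not at h
    obtain ⟨k, hk⟩ := h
    obtain ⟨i, -, hi⟩ := Finset.exists_max_image Finset.univ z ⟨k, Finset.mem_univ k⟩
    rw [Finset.sum_eq_single i]
    · rw [bestAssetSlope, if_pos, zero_sub]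
      exact ⟨hk.trans_le (hi k (Finset.mem_univ k)), fun j hj =>
        lt_of_le_of_ne (hi j (Finset.mem_univ j)) (hinj j i hj)⟩
    · intro j _ hj
      exact if_neg fun hjb => (hjb.2 i hj.symm).not_ge (hi j (Finset.mem_univ j))
    · simp

end Path

/-! ### Look-back prices -/

/-- A market on `[0, T]` with right-continuous paths and integrable maxima. -/
structure IsIntegrableMarket {Ω : Type*} [MeasurableSpace Ω] {n : ℕ} (Q : Measure Ω)
    (S : Fin n → ℝ → Ω → ℝ) (T : ℝ) : Prop where
  measurable : ∀ i, ∀ t ∈ Icc 0 T, Measurable (S i t)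
  rightContinuous : ∀ i, ∀ᵐ ω ∂Q, ∀ t ∈ Ico 0 T, ContinuousWithinAt (fun u => S i u ω) (Ici t) t
  bddAbove : ∀ i, ∀ᵐ ω ∂Q, BddAbove (range fun u : Icc (0 : ℝ) T => S i u ω)
  integrable_iSup : ∀ i, Integrable (fun ω => ⨆ u : Icc (0 : ℝ) T, S i u ω) Q

namespace IsIntegrableMarket

variable {Ω : Type*} [MeasurableSpace Ω] {n : ℕ} {Q : Measure Ω} {S : Fin n → ℝ → Ω → ℝ}
  {T t₀ t₁ : ℝ}

theorem ae_bddAbove (hM : IsIntegrableMarket Q S T) :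
    ∀ᵐ ω ∂Q, ∀ i, BddAbove (range fun u : Icc (0 : ℝ) T => S i u ω) :=
  ae_all_iff.2 hM.bddAbove

theorem ae_rightContinuous (hM : IsIntegrableMarket Q S T) :
    ∀ᵐ ω ∂Q, ∀ i, ∀ t ∈ Ico 0 T, ContinuousWithinAt (fun u => S i u ω) (Ici t) t :=
  ae_all_iff.2 hM.rightContinuous

theorem integrable_bound [IsFiniteMeasure Q] (hM : IsIntegrableMarket Q S T) (x : Fin n → ℝ) :
    Integrable (fun ω => ∑ i, (|⨆ u : Icc (0 : ℝ) T, S i u ω| + |x i|)) Q :=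
  integrable_finsetSum _ fun i _ => (hM.integrable_iSup i).abs.add (integrable_const _)

theorem aestronglyMeasurable_lookbackPayoff [NeZero n] (hM : IsIntegrableMarket Q S T)
    (h₀ : 0 ≤ t₀) (h₀₁ : t₀ ≤ t₁) (h₁ : t₁ ≤ T) (x : Fin n → ℝ) :
    AEStronglyMeasurable (lookbackPayoff S t₀ t₁ x) Q := by
  have : Countable (lookbackTimes t₀ t₁) := (countable_lookbackTimes t₀ t₁).to_subtype
  have hm : Measurable fun ω => ⨆ i, ⨆ u : lookbackTimes t₀ t₁, max (S i u ω - x i) 0 := by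
    refine Measurable.iSup fun i => Measurable.iSup fun u => ?_
    have hu := lookbackTimes_subset h₀₁ u.2
    exact ((hM.measurable i u ⟨h₀.trans hu.1, hu.2.trans h₁⟩).sub_const _).max measurable_const
  refine hm.aestronglyMeasurable.congr ?_
  filter_upwards [hM.ae_bddAbove, hM.ae_rightContinuous] with ω hb hrc
  exact (lookbackPayoff_eq_iSup_lookbackTimes h₀ h₀₁ h₁ hb hrc x).symm

theorem integrable_lookbackPayoff [NeZero n] [IsFiniteMeasure Q] (hM : IsIntegrableMarket Q S T)
    (h₀ : 0 ≤ t₀) (h₀₁ : t₀ ≤ t₁) (h₁ : t₁ ≤ T) (x : Fin n → ℝ) :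
    Integrable (lookbackPayoff S t₀ t₁ x) Q := by
  refine (hM.integrable_bound x).mono'
    (hM.aestronglyMeasurable_lookbackPayoff h₀ h₀₁ h₁ x) ?_
  filter_upwards [hM.ae_bddAbove] with ω hb
  exact abs_lookbackPayoff_le h₀ h₀₁ h₁ hb x

theorem lipschitzWith_lookbackPrice [NeZero n] [IsProbabilityMeasure Q]
    (hM : IsIntegrableMarket Q S T) (h₀ : 0 ≤ t₀) (h₀₁ : t₀ ≤ t₁) (h₁ : t₁ ≤ T) :
    LipschitzWith 1 (lookbackPrice Q S t₀ t₁) := by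
  refine LipschitzWith.of_dist_le_mul fun x x' => ?_
  rw [Real.dist_eq, lookbackPrice, lookbackPrice, ← integral_sub
    (hM.integrable_lookbackPayoff h₀ h₀₁ h₁ x) (hM.integrable_lookbackPayoff h₀ h₀₁ h₁ x'),
    ← Real.norm_eq_abs]
  have := norm_integral_le_of_norm_le_const (μ := Q) (C := dist x x')
    (f := fun ω => lookbackPayoff S t₀ t₁ x ω - lookbackPayoff S t₀ t₁ x' ω) (by
      filter_upwards [hM.ae_bddAbove] with ω hb
      exact lookbackPayoff_sub_le h₀ h₀₁ h₁ hb x x')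
  simpa using this

/-- Rademacher's theorem: the price inherits the Lipschitz constant `1` of the payoff. -/
theorem ae_partialExists_lookbackPrice [NeZero n] [IsProbabilityMeasure Q]
    (hM : IsIntegrableMarket Q S T) (h₀ : 0 ≤ t₀) (h₀₁ : t₀ ≤ t₁) (h₁ : t₁ ≤ T) :
    ∀ᵐ x ∂(volume : Measure (Fin n → ℝ)), ∀ i, PartialExists i (lookbackPrice Q S t₀ t₁) x := by
  filter_upwards [(hM.lipschitzWith_lookbackPrice h₀ h₀₁ h₁).ae_differentiableAt
    (μ := volume)] with x hx i
  have h : DifferentiableAt ℝ (lookbackPrice Q S t₀ t₁) (Function.update x i (x i)) := by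
    rwa [Function.update_eq_self]
  exact h.comp (x i) (hasDerivAt_update x i (x i)).differentiableAt

theorem convexOn_lookbackPrice_update [NeZero n] [IsFiniteMeasure Q]
    (hM : IsIntegrableMarket Q S T) (h₀ : 0 ≤ t₀) (h₀₁ : t₀ ≤ t₁) (h₁ : t₁ ≤ T)
    (x : Fin n → ℝ) (i : Fin n) :
    ConvexOn ℝ univ fun y => lookbackPrice Q S t₀ t₁ (Function.update x i y) := by
  refine ⟨convex_univ, fun y _ y' _ a b ha hb hab => ?_⟩
  have hupd : Function.update x i (a • y + b • y') =
      a • Function.update x i y + b • Function.update x i y' := by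
    funext j
    by_cases hj : j = i
    · subst hj
      simp
    · simp only [Function.update_of_ne hj, Pi.add_apply, Pi.smul_apply, smul_eq_mul]
      rw [← add_mul, hab, one_mul]
  have hint := fun x => hM.integrable_lookbackPayoff h₀ h₀₁ h₁ x
  simp only [lookbackPrice, smul_eq_mul] at hupd ⊢
  rw [← integral_const_mul, ← integral_const_mul, ← integral_add ((hint _).const_mul a)
    ((hint _).const_mul b), hupd]
  refine integral_mono_ae (hint _) (((hint _).const_mul a).add ((hint _).const_mul b)) ?_
  filter_upwards [hM.ae_bddAbove] with ω hb'
  exact (convexOn_lookbackPayoff h₀ h₀₁ h₁ hb').2 (mem_univ _) (mem_univ _) ha hb hab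

theorem tendsto_lookbackPrice [NeZero n] [IsFiniteMeasure Q] (hM : IsIntegrableMarket Q S T)
    {t : ℝ} (ht : t ∈ Ico 0 T) (x : Fin n → ℝ) :
    Tendsto (fun s => lookbackPrice Q S t (t + s) x) (𝓝[>] 0) (𝓝 (lookbackPrice Q S t t x)) := by
  have hsmall : ∀ᶠ s in 𝓝[>] (0 : ℝ), t ≤ t + s ∧ t + s ≤ T := by
    filter_upwards [Ioo_mem_nhdsGT (sub_pos.2 ht.2)] with s hs
    exact ⟨by linarith [hs.1], by linarith [hs.2]⟩
  refine tendsto_integral_filter_of_dominated_convergence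
    (fun ω => ∑ i, (|⨆ u : Icc (0 : ℝ) T, S i u ω| + |x i|)) ?_ ?_ (hM.integrable_bound x) ?_
  · filter_upwards [hsmall] with s hs
    exact hM.aestronglyMeasurable_lookbackPayoff ht.1 hs.1 hs.2 x
  · filter_upwards [hsmall] with s hs
    filter_upwards [hM.ae_bddAbove] with ω hb
    exact abs_lookbackPayoff_le ht.1 hs.1 hs.2 hb x
  · filter_upwards [hM.ae_bddAbove, hM.ae_rightContinuous] with ω hb hrc
    exact tendsto_lookbackPayoff ht hb hrc x

theorem instantLookbackPrice_eq [NeZero n] [IsFiniteMeasure Q] (hM : IsIntegrableMarket Q S T)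
    {t : ℝ} (ht : t ∈ Ico 0 T) : instantLookbackPrice Q S t = lookbackPrice Q S t t :=
  funext fun x => (hM.tendsto_lookbackPrice ht x).limUnder_eq

theorem measurable_bestAssetSlope (hM : IsIntegrableMarket Q S T) {t : ℝ} (ht : t ∈ Icc 0 T)
    (x : Fin n → ℝ) (i : Fin n) :
    Measurable fun ω => bestAssetSlope (fun j => S j t ω - x j) i := by
  classical
  have hm : ∀ j, Measurable fun ω => S j t ω - x j := fun j => (hM.measurable j t ht).sub_const _
  have hall : MeasurableSet {ω | ∀ j, j ≠ i → S j t ω - x j < S i t ω - x i} := by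
    simp only [Set.ofPred_forall]
    exact MeasurableSet.iInter fun j => MeasurableSet.iInter fun _ =>
      measurableSet_lt (hm j) (hm i)
  have hset : MeasurableSet {ω | 0 < S i t ω - x i ∧
      ∀ j, j ≠ i → S j t ω - x j < S i t ω - x i} :=
    (measurableSet_lt measurable_const (hm i)).inter hall
  unfold bestAssetSlope
  exact Measurable.ite (by convert hset) measurable_const measurable_const

/-- The payoff is `1`-Lipschitz in the strike, so differentiating under the expectation requires
differentiability only at the one point `x i`, almost surely. -/
theorem hasDerivAt_lookbackPrice_self [NeZero n] [IsProbabilityMeasure Q]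
    (hM : IsIntegrableMarket Q S T) {t : ℝ} (ht : t ∈ Icc 0 T) (x : Fin n → ℝ)
    (h0 : ∀ᵐ ω ∂Q, ∀ i, S i t ω - x i ≠ 0)
    (hinj : ∀ᵐ ω ∂Q, ∀ i j, i ≠ j → S i t ω - x i ≠ S j t ω - x j) (i : Fin n) :
    Integrable (fun ω => bestAssetSlope (fun j => S j t ω - x j) i) Q ∧
    HasDerivAt (fun y => lookbackPrice Q S t t (Function.update x i y))
      (∫ ω, bestAssetSlope (fun j => S j t ω - x j) i ∂Q) (x i) := by
  refine hasDerivAt_integral_of_dominated_loc_of_lip (bound := fun _ => (1 : ℝ)) (s := univ)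
    univ_mem (Eventually.of_forall fun y =>
      hM.aestronglyMeasurable_lookbackPayoff ht.1 le_rfl ht.2 _)
    (hM.integrable_lookbackPayoff ht.1 le_rfl ht.2 _)
    (hM.measurable_bestAssetSlope ht x i).aestronglyMeasurable ?_ (integrable_const _) ?_
  · filter_upwards [hM.ae_bddAbove] with ω hb
    refine LipschitzOnWith.of_dist_le_mul fun y _ y' _ => ?_
    rw [Real.dist_eq]
    refine (lookbackPayoff_sub_le ht.1 le_rfl ht.2 hb _ _).trans ?_
    simp only [map_one, NNReal.coe_one, one_mul]
    refine (dist_pi_le_iff dist_nonneg).2 fun j => ?_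
    by_cases hj : j = i
    · subst hj
      simp
    · simp [hj]
  · filter_upwards [hM.ae_bddAbove, h0, hinj] with ω hb h0 hinj
    exact hasDerivAt_lookbackPayoff_self ht hb x h0 hinj i

theorem sum_partialDeriv_lookbackPrice_self [NeZero n] [IsProbabilityMeasure Q]
    (hM : IsIntegrableMarket Q S T) {t : ℝ} (ht : t ∈ Icc 0 T) (x : Fin n → ℝ)
    (h0 : ∀ᵐ ω ∂Q, ∀ i, S i t ω - x i ≠ 0)
    (hinj : ∀ᵐ ω ∂Q, ∀ i j, i ≠ j → S i t ω - x i ≠ S j t ω - x j) :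
    ∑ i, partialDeriv i (lookbackPrice Q S t t) x =
      (Q.map fun ω i => S i t ω).real (Iic x) - 1 := by
  classical
  have hd := hM.hasDerivAt_lookbackPrice_self ht x h0 hinj
  have hmS : Measurable fun ω i => S i t ω := measurable_pi_lambda _ fun i => hM.measurable i t ht
  have hset : MeasurableSet ((fun ω i => S i t ω) ⁻¹' Iic x) := hmS measurableSet_Iic
  simp only [partialDeriv, fun i => (hd i).2.deriv]
  rw [← integral_finsetSum _ fun i _ => (hd i).1]
  have hcongr : ∀ᵐ ω ∂Q, ∑ i, bestAssetSlope (fun j => S j t ω - x j) i =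
      ((fun ω i => S i t ω) ⁻¹' Iic x).indicator (fun _ => (1 : ℝ)) ω - 1 := by
    filter_upwards [hinj] with ω hω
    rw [sum_bestAssetSlope _ hω]
    simp only [sub_nonpos, indicator_apply, mem_preimage, mem_Iic, Pi.le_def]
  rw [integral_congr_ae hcongr, integral_sub ((integrable_const _).indicator hset)
    (integrable_const _), integral_indicator hset, map_measureReal_apply hmS measurableSet_Iic]
  simp

end IsIntegrableMarket

/-! ### Marginal laws and the control measure -/

/-- If the space-time law of a process has density `ρ`, then at almost every time the law of the
process has density `ρ (t, ·)`. -/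
theorem ae_map_eq_withDensity {Ω E 𝕋 : Type*} [MeasurableSpace Ω] [MeasurableSpace E]
    [MeasurableSpace 𝕋] [MeasurableSpace.CountablyGenerated E] {Q : Measure Ω} [IsFiniteMeasure Q]
    {m : Measure 𝕋} [SigmaFinite m] {τ : Measure E} [SFinite τ] {A : Set 𝕋} (hA : MeasurableSet A)
    {X : 𝕋 × Ω → E} (hX : AEMeasurable X ((m.restrict A).prod Q)) {ρ : 𝕋 × E → ENNReal}
    (hρ : Measurable ρ)
    (h : ((m.restrict A).prod Q).map (fun p => (p.1, X p)) = (m.prod τ).withDensity ρ) :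
    ∀ᵐ t ∂m.restrict A, Q.map (fun ω => X (t, ω)) = τ.withDensity fun y => ρ (t, y) := by
  have hY : Measurable (hX.mk X) := hX.measurable_mk
  have hXY : ∀ᵐ t ∂m.restrict A, ∀ᵐ ω ∂Q, X (t, ω) = hX.mk X (t, ω) :=
    Measure.ae_ae_of_ae_prod hX.ae_eq_mk
  have hmap : ((m.restrict A).prod Q).map (fun p => (p.1, hX.mk X p)) =
      (m.prod τ).withDensity ρ := by
    rw [← h]
    refine Measure.map_congr ?_
    filter_upwards [hX.ae_eq_mk] with p hp
    rw [hp]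
  -- For a fixed `B`, both sides have the same integral over every time set; the exceptional times
  -- may depend on `B`.
  have hB : ∀ B, MeasurableSet B → ∀ᵐ t ∂m.restrict A,
      Q.map (fun ω => hX.mk X (t, ω)) B = τ.withDensity (fun y => ρ (t, y)) B := by
    intro B hB
    have hpre : MeasurableSet (hX.mk X ⁻¹' B) := hY hB
    have hleft : ∀ t, Q.map (fun ω => hX.mk X (t, ω)) B = Q (Prod.mk t ⁻¹' (hX.mk X ⁻¹' B)) :=
      fun t => Measure.map_apply (hY.comp measurable_prodMk_left) hB
    have hright : ∀ t, τ.withDensity (fun y => ρ (t, y)) B = ∫⁻ y in B, ρ (t, y) ∂τ :=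
      fun t => withDensity_apply _ hB
    simp only [hleft, hright]
    refine ae_eq_of_forall_setLIntegral_eq_of_sigmaFinite
      (measurable_measure_prodMk_left hpre) hρ.lintegral_prod_right' fun s hs _ => ?_
    -- The measure on the right is not restricted in time, so the rectangle is based on `s ∩ A`.
    have h1 : ((m.restrict A).prod Q).map (fun p => (p.1, hX.mk X p)) ((s ∩ A) ×ˢ B) =
        (m.prod τ).withDensity ρ ((s ∩ A) ×ˢ B) := by rw [hmap]
    rw [withDensity_apply _ ((hs.inter hA).prod hB), setLIntegral_prod _ hρ.aemeasurable,
      Measure.map_apply (measurable_fst.prodMk hY) ((hs.inter hA).prod hB)] at h1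
    rw [Measure.restrict_restrict hs, ← h1]
    have h2 : (fun p => (p.1, hX.mk X p)) ⁻¹' ((s ∩ A) ×ˢ B) =
        ((s ∩ A) ×ˢ univ) ∩ hX.mk X ⁻¹' B := by
      ext p
      simp
    rw [h2, inter_comm _ (hX.mk X ⁻¹' B), ← Measure.restrict_apply hpre, ← Measure.prod_restrict,
      Measure.restrict_univ, Measure.prod_apply hpre, Measure.restrict_restrict (hs.inter hA)]
    congr 2
    rw [inter_assoc, inter_self]
  -- A countable generating algebra makes the exceptional times independent of `B`; being closed
  -- under intersections, it determines a finite measure once the total masses agree.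
  set C : Set (Set E) := generateSetAlgebra (MeasurableSpace.countableGeneratingSet E) with hC
  have hgen : ‹MeasurableSpace E› = MeasurableSpace.generateFrom C := by
    rw [hC, generateFrom_generateSetAlgebra_eq,
      MeasurableSpace.generateFrom_countableGeneratingSet]
  have hCm : ∀ B ∈ C, MeasurableSet B := fun B hBC =>
    hgen ▸ MeasurableSpace.measurableSet_generateFrom hBC
  have hall : ∀ᵐ t ∂m.restrict A, ∀ B ∈ C,
      Q.map (fun ω => hX.mk X (t, ω)) B = τ.withDensity (fun y => ρ (t, y)) B :=
    (ae_ball_iff (countable_generateSetAlgebra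
      MeasurableSpace.countable_countableGeneratingSet)).2 fun B hBC => hB B (hCm B hBC)
  filter_upwards [hXY, hall, hB univ MeasurableSet.univ] with t ht htB htu
  rw [Measure.map_congr ht]
  exact ext_of_generate_finite C hgen
    (fun s hs s' hs' _ => isSetAlgebra_generateSetAlgebra.inter_mem hs hs') htB htu

/-- Ties form a translate of the hyperplane `y i = y j`, a proper subspace and hence a null set. -/
theorem ae_sub_ne_sub {n : ℕ} (x : Fin n → ℝ) {i j : Fin n} (hij : i ≠ j) :
    ∀ᵐ y : Fin n → ℝ, y i - x i ≠ y j - x j := by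
  set L : (Fin n → ℝ) →ₗ[ℝ] ℝ :=
    (LinearMap.proj i : (Fin n → ℝ) →ₗ[ℝ] ℝ) - LinearMap.proj j with hL
  have hker : LinearMap.ker L ≠ ⊤ := by
    intro htop
    have h1 : Pi.single i (1 : ℝ) ∈ LinearMap.ker L := htop ▸ Submodule.mem_top
    simp [hL, hij.symm] at h1
  have h0 := (measurePreserving_sub_right (volume : Measure (Fin n → ℝ)) x).quasiMeasurePreserving
    |>.preimage_null (Measure.addHaar_submodule volume _ hker)
  refine measure_mono_null ?_ h0
  intro y hy
  simpa [hL, sub_eq_zero] using hy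

theorem asianBasketPayoff_eq {Ω : Type*} {n : ℕ} {S : Fin n → ℝ → Ω → ℝ} {T : ℝ} (hT : 0 ≤ T)
    (K : Fin n → ℝ) (ω : Ω) :
    asianBasketPayoff S T K ω = ∫ t in Icc 0 T, ∑ i, max (S i t ω - K i) 0 := by
  rw [asianBasketPayoff, intervalIntegral.integral_of_le hT, integral_Icc_eq_integral_Ioc]

section Control

variable {Ω : Type*} [MeasurableSpace Ω] {n : ℕ} {Q : Measure Ω} [IsProbabilityMeasure Q]
  {S : Fin n → ℝ → Ω → ℝ} {T : ℝ}

instance : IsFiniteMeasure (controlMeasure Q S T) := by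
  unfold controlMeasure
  infer_instance

namespace IsIntegrableMarket

theorem aemeasurable_spaceTime (hM : IsIntegrableMarket Q S T) :
    AEMeasurable (fun p : ℝ × Ω => (p.1, fun i => S i p.1 p.2))
      ((volume.restrict (Icc 0 T)).prod Q) :=
  _root_.aemeasurable_spaceTime Q S T hM.measurable hM.rightContinuous

theorem ae_map_eq_withDensity_rnDeriv (hM : IsIntegrableMarket Q S T)
    (hac : controlMeasure Q S T ≪ volume) :
    ∀ᵐ t ∂(volume.restrict (Icc 0 T)), (Q.map fun ω i => S i t ω) =
      volume.withDensity fun y => (controlMeasure Q S T).rnDeriv volume (t, y) :=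
  ae_map_eq_withDensity (X := fun p : ℝ × Ω => fun i => S i p.1 p.2) measurableSet_Icc
    (measurable_snd.comp_aemeasurable hM.aemeasurable_spaceTime)
    (Measure.measurable_rnDeriv (controlMeasure Q S T) volume)
    (Measure.withDensity_rnDeriv_eq _ _ hac).symm

/-- At almost every time there are almost surely no ties between the moneynesses `S_i - x_i`, and the
distribution function of the prices is the integral of the density of the control measure. -/
theorem ae_noTies_and_cdf (hM : IsIntegrableMarket Q S T)
    (hac : controlMeasure Q S T ≪ volume) :
    ∀ᵐ t ∂(volume.restrict (Ioo 0 T)), ∀ x : Fin n → ℝ,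
      (∀ᵐ ω ∂Q, ∀ i, S i t ω - x i ≠ 0) ∧
      (∀ᵐ ω ∂Q, ∀ i j, i ≠ j → S i t ω - x i ≠ S j t ω - x j) ∧
      (Q.map fun ω i => S i t ω).real (Iic x) =
        ∫ y in Iic x, ((controlMeasure Q S T).rnDeriv volume (t, y)).toReal := by
  have hlt : ∀ᵐ t : ℝ, ∀ᵐ y : Fin n → ℝ, (controlMeasure Q S T).rnDeriv volume (t, y) < ⊤ :=
    Measure.ae_ae_of_ae_prod (Measure.rnDeriv_lt_top (controlMeasure Q S T) volume)
  filter_upwards [ae_restrict_of_ae_restrict_of_subset Ioo_subset_Icc_self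
    (hM.ae_map_eq_withDensity_rnDeriv hac), ae_restrict_of_ae hlt,
    ae_restrict_mem measurableSet_Ioo] with t ht htlt htm x
  have hmS : Measurable fun ω i => S i t ω :=
    measurable_pi_lambda _ fun i => hM.measurable i t (Ioo_subset_Icc_self htm)
  -- The exceptional times are already fixed here: a density of the law at this `t` handles every
  -- `x`, so they do not depend on `x`.
  have hac' : (Q.map fun ω i => S i t ω) ≪ volume := by
    rw [ht]
    exact withDensity_absolutelyContinuous _ _
  refine ⟨?_, ?_, ?_⟩
  · refine ae_all_iff.2 fun i => ?_
    have h1 : ∀ᵐ y : Fin n → ℝ, y i ≠ x i :=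
      Measure.ae_eval_ne (fun _ : Fin n => (volume : Measure ℝ)) i (x i)
    filter_upwards [ae_of_ae_map hmS.aemeasurable (hac'.ae_le h1)] with ω hω
    exact sub_ne_zero.2 hω
  · refine ae_all_iff.2 fun i => ae_all_iff.2 fun j => ?_
    by_cases hij : i = j
    · exact Eventually.of_forall fun ω h => absurd hij h
    refine Eventually.mono ?_ fun ω hω _ => hω
    exact ae_of_ae_map hmS.aemeasurable (hac'.ae_le (ae_sub_ne_sub x hij))
  · rw [measureReal_def, ht, withDensity_apply _ measurableSet_Iic]
    exact (integral_toReal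
      ((Measure.measurable_rnDeriv _ _).comp measurable_prodMk_left).aemeasurable
      (ae_restrict_of_ae htlt)).symm

/-- The two time endpoints are null for `dt`, and the faces where a price vanishes are null by
absolute continuity; nonnegativity does the rest. -/
theorem ae_controlMeasure_mem (hM : IsIntegrableMarket Q S T)
    (hnonneg : ∀ i, ∀ t ∈ Icc 0 T, ∀ᵐ ω ∂Q, 0 ≤ S i t ω) (hac : controlMeasure Q S T ≪ volume) :
    ∀ᵐ p ∂controlMeasure Q S T, p ∈ Ioo 0 T ×ˢ positiveOrthant n := by
  have h1 : ∀ᵐ p ∂controlMeasure Q S T, p.1 ∈ Ioo 0 T := by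
    refine (ae_map_iff hM.aemeasurable_spaceTime (measurable_fst measurableSet_Ioo)).2 ?_
    have h : ∀ᵐ t ∂(volume.restrict (Icc (0 : ℝ) T)), t ∈ Ioo 0 T := by
      rw [← restrict_Ioo_eq_restrict_Icc]
      exact ae_restrict_mem measurableSet_Ioo
    exact Measure.quasiMeasurePreserving_fst.ae h
  have h2 : ∀ᵐ p ∂controlMeasure Q S T, ∀ i, p.2 i ≠ 0 := by
    refine hac.ae_le (ae_all_iff.2 fun i => ?_)
    exact Measure.quasiMeasurePreserving_snd.ae
      (Measure.ae_eval_ne (fun _ : Fin n => (volume : Measure ℝ)) i 0)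
  have h3 : ∀ᵐ p ∂controlMeasure Q S T, ∀ i, 0 ≤ p.2 i := by
    refine ae_all_iff.2 fun i => ?_
    have hm : MeasurableSet {p : ℝ × (Fin n → ℝ) | 0 ≤ p.2 i} :=
      measurableSet_le measurable_const (by fun_prop)
    refine (ae_map_iff hM.aemeasurable_spaceTime hm).2 ?_
    have hX := hM.aemeasurable_spaceTime
    have hae := hX.ae_eq_mk
    -- Nonnegativity has a null set depending on `t`; combining these into a product null set
    -- requires a measurable set, hence the measurable version of the space-time map.
    have hY : ∀ᵐ p ∂(volume.restrict (Icc 0 T)).prod Q, 0 ≤ (hX.mk _ p).2 i := by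
      refine (Measure.ae_prod_iff_ae_ae (hX.measurable_mk hm)).2 ?_
      filter_upwards [Measure.ae_ae_of_ae_prod hae, ae_restrict_mem measurableSet_Icc] with t ht htm
      filter_upwards [ht, hnonneg i t htm] with ω hω h0
      rw [← hω]
      exact h0
    filter_upwards [hY, hae] with p hp hpe
    rw [← hpe] at hp
    exact hp
  filter_upwards [h1, h2, h3] with p hp1 hp2 hp3
  exact ⟨hp1, fun i => lt_of_le_of_ne (hp3 i) (hp2 i).symm⟩

theorem integrable_call_prod (hM : IsIntegrableMarket Q S T) (K : Fin n → ℝ) (i : Fin n) :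
    Integrable (fun p : ℝ × Ω => max (S i p.1 p.2 - K i) 0)
      ((volume.restrict (Icc 0 T)).prod Q) := by
  have hmeas : AEMeasurable (fun p : ℝ × Ω => max (S i p.1 p.2 - K i) 0)
      ((volume.restrict (Icc 0 T)).prod Q) := by
    have h : Measurable fun p : ℝ × (Fin n → ℝ) => max (p.2 i - K i) 0 := by fun_prop
    exact h.comp_aemeasurable hM.aemeasurable_spaceTime
  have hbound : Integrable (fun p : ℝ × Ω => |⨆ u : Icc (0 : ℝ) T, S i u p.2| + |K i|)
      ((volume.restrict (Icc 0 T)).prod Q) :=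
    (((hM.integrable_iSup i).abs.add (integrable_const |K i|)).comp_snd _)
  refine hbound.mono' hmeas.aestronglyMeasurable ?_
  have h1 : ∀ᵐ p ∂(volume.restrict (Icc 0 T)).prod Q, p.1 ∈ Icc 0 T :=
    Measure.quasiMeasurePreserving_fst.ae (ae_restrict_mem measurableSet_Icc)
  have h2 : ∀ᵐ p ∂(volume.restrict (Icc 0 T)).prod Q,
      BddAbove (range fun u : Icc (0 : ℝ) T => S i u p.2) :=
    Measure.quasiMeasurePreserving_snd.ae (hM.bddAbove i)
  filter_upwards [h1, h2] with p hp hb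
  rw [Real.norm_of_nonneg (le_max_right _ _)]
  have h3 : S i p.1 p.2 ≤ ⨆ u : Icc (0 : ℝ) T, S i u p.2 := le_ciSup hb ⟨p.1, hp⟩
  refine max_le ?_ (by positivity)
  linarith [le_abs_self (⨆ u : Icc (0 : ℝ) T, S i u p.2), neg_abs_le (K i)]

theorem integrable_asianBasketPayoff (hM : IsIntegrableMarket Q S T) (hT : 0 ≤ T)
    (K : Fin n → ℝ) : Integrable (asianBasketPayoff S T K) Q := by
  have h := (integrable_finsetSum Finset.univ fun i _ =>
    hM.integrable_call_prod K i).integral_prod_right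
  exact h.congr (Eventually.of_forall fun ω => (asianBasketPayoff_eq hT K ω).symm)

theorem integrable_call_controlMeasure (hM : IsIntegrableMarket Q S T) (K : Fin n → ℝ)
    (i : Fin n) :
    Integrable (fun p : ℝ × (Fin n → ℝ) => max (p.2 i - K i) 0) (controlMeasure Q S T) := by
  have h : Measurable fun p : ℝ × (Fin n → ℝ) => max (p.2 i - K i) 0 := by fun_prop
  exact (integrable_map_measure h.aestronglyMeasurable hM.aemeasurable_spaceTime).2
    (hM.integrable_call_prod K i)

/-- Fubini turns the price into an integral over time and scenarios, and the control measure is the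
image of that product measure. -/
theorem asianBasketPrice_eq (hM : IsIntegrableMarket Q S T) (hT : 0 ≤ T) (K : Fin n → ℝ) :
    asianBasketPrice Q S T K = ∑ i, ∫ p, max (p.2 i - K i) 0 ∂controlMeasure Q S T := by
  have hswap := integral_prod_symm _ (integrable_finsetSum Finset.univ fun i _ =>
    hM.integrable_call_prod K i)
  rw [asianBasketPrice]
  simp only [asianBasketPayoff_eq hT]
  rw [← hswap, integral_finsetSum _ fun i _ => hM.integrable_call_prod K i]
  refine Finset.sum_congr rfl fun i _ => ?_
  have h : Measurable fun p : ℝ × (Fin n → ℝ) => max (p.2 i - K i) 0 := by fun_prop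
  exact (integral_map hM.aemeasurable_spaceTime h.aestronglyMeasurable).symm

end IsIntegrableMarket

end Control

/-! ### State-price density -/

theorem measurableSet_positiveOrthant (n : ℕ) : MeasurableSet (positiveOrthant n) := by
  simp only [positiveOrthant, Set.ofPred_forall]
  exact MeasurableSet.iInter fun i => measurableSet_lt measurable_const (measurable_pi_apply i)

namespace IsIntegrableMarket

variable {Ω : Type*} [MeasurableSpace Ω] {n : ℕ} {Q : Measure Ω}
  [IsProbabilityMeasure Q] {S : Fin n → ℝ → Ω → ℝ} {T : ℝ}

theorem ae_sumLookbackPartials_eq [NeZero n] (hM : IsIntegrableMarket Q S T)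
    (hac : controlMeasure Q S T ≪ volume) :
    ∀ᵐ t ∂(volume.restrict (Ioo 0 T)), ∀ x : Fin n → ℝ, sumLookbackPartials Q S t x =
      (∫ y in Iic x, ((controlMeasure Q S T).rnDeriv volume (t, y)).toReal) + -1 := by
  filter_upwards [hM.ae_noTies_and_cdf hac, ae_restrict_mem measurableSet_Ioo] with t ht htm x
  obtain ⟨h0, hinj, hcdf⟩ := ht x
  rw [sumLookbackPartials, hM.instantLookbackPrice_eq ⟨htm.1.le, htm.2⟩,
    hM.sum_partialDeriv_lookbackPrice_self (Ioo_subset_Icc_self htm) x h0 hinj, hcdf,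
    sub_eq_add_neg]

theorem ae_statePriceDensity_eq [NeZero n] (hM : IsIntegrableMarket Q S T)
    (hac : controlMeasure Q S T ≪ volume) :
    ∀ᵐ p ∂(volume.restrict (Ioo 0 T ×ˢ positiveOrthant n)),
      IteratedPartialExists (List.finRange n) (sumLookbackPartials Q S p.1) p.2 ∧
      statePriceDensity Q S p.1 p.2 = ((controlMeasure Q S T).rnDeriv volume p).toReal := by
  have hint : ∀ᵐ t : ℝ, Integrable fun y : Fin n → ℝ =>
      ((controlMeasure Q S T).rnDeriv volume (t, y)).toReal :=
    (Measure.integrable_toReal_rnDeriv (μ := controlMeasure Q S T)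
      (ν := (volume : Measure ℝ).prod volume)).prod_right_ae
  -- Time is the initial parameter, and the constant is the `-1` from the sum of slopes, harmless
  -- because `n` is positive.
  have h := ae_iteratedPartial_cdf n (volume.restrict (Ioo 0 T))
    (fun p => ((controlMeasure Q S T).rnDeriv volume p).toReal)
    (Measure.measurable_rnDeriv _ _).ennreal_toReal (fun _ => ENNReal.toReal_nonneg)
    (ae_restrict_of_ae hint) (sumLookbackPartials Q S) (-1)
    (fun h => absurd h (NeZero.ne n)) (hM.ae_sumLookbackPartials_eq hac)
  have hle : (volume : Measure (ℝ × (Fin n → ℝ))).restrict (Ioo 0 T ×ˢ positiveOrthant n) ≤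
      (volume.restrict (Ioo 0 T)).prod volume := by
    have h2 : (volume.restrict (Ioo 0 T)).prod (volume : Measure (Fin n → ℝ)) =
        volume.restrict (Ioo 0 T ×ˢ univ) := by
      rw [Measure.volume_eq_prod, ← Measure.prod_restrict, Measure.restrict_univ]
    rw [h2]
    exact Measure.restrict_mono (prod_mono subset_rfl (subset_univ _)) le_rfl
  exact ae_mono hle h

theorem integrable_call_mul_rnDeriv (hM : IsIntegrableMarket Q S T)
    (hac : controlMeasure Q S T ≪ volume) (K : Fin n → ℝ) (i : Fin n) :
    Integrable (fun p : ℝ × (Fin n → ℝ) =>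
      max (p.2 i - K i) 0 * ((controlMeasure Q S T).rnDeriv volume p).toReal) := by
  have h := (integrable_rnDeriv_smul_iff hac).2 (hM.integrable_call_controlMeasure K i)
  simpa only [smul_eq_mul, mul_comm] using h

theorem integrableOn_call_mul_statePriceDensity [NeZero n] (hM : IsIntegrableMarket Q S T)
    (hac : controlMeasure Q S T ≪ volume) (K : Fin n → ℝ) (i : Fin n) :
    IntegrableOn (fun p : ℝ × (Fin n → ℝ) =>
        max (p.2 i - K i) 0 * statePriceDensity Q S p.1 p.2)
      (Ioo 0 T ×ˢ positiveOrthant n) volume := by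
  refine (hM.integrable_call_mul_rnDeriv hac K i).integrableOn.congr ?_
  filter_upwards [hM.ae_statePriceDensity_eq hac] with p hp
  rw [hp.2]

theorem integral_call_controlMeasure [NeZero n] (hM : IsIntegrableMarket Q S T) (hT : 0 ≤ T)
    (hnonneg : ∀ i, ∀ t ∈ Icc 0 T, ∀ᵐ ω ∂Q, 0 ≤ S i t ω)
    (hac : controlMeasure Q S T ≪ volume) (K : Fin n → ℝ) (i : Fin n) :
    ∫ p, max (p.2 i - K i) 0 ∂controlMeasure Q S T =
      ∫ t in (0 : ℝ)..T, ∫ x in positiveOrthant n,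
        max (x i - K i) 0 * statePriceDensity Q S t x := by
  have hm : MeasurableSet (Ioo 0 T ×ˢ positiveOrthant n) :=
    measurableSet_Ioo.prod (measurableSet_positiveOrthant n)
  -- The control measure is carried by the open region on which the mixed derivative is identified
  -- a.e. with the density, so restricting to it loses no mass.
  rw [← Measure.restrict_eq_self_of_ae_mem (hM.ae_controlMeasure_mem hnonneg hac),
    ← setIntegral_rnDeriv_smul hac hm, intervalIntegral.integral_of_le hT,
    integral_Ioc_eq_integral_Ioo]
  have hprod := setIntegral_prod (μ := (volume : Measure ℝ))
    (ν := (volume : Measure (Fin n → ℝ))) _ (hM.integrableOn_call_mul_statePriceDensity hac K i)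
  refine Eq.trans (integral_congr_ae ?_) hprod
  filter_upwards [hM.ae_statePriceDensity_eq hac] with p hp
  rw [hp.2, smul_eq_mul, mul_comm]

end IsIntegrableMarket

theorem mainTheorem5 {Ω : Type*} [MeasurableSpace Ω]
    (Q : MeasureTheory.Measure Ω) [MeasureTheory.IsProbabilityMeasure Q]
    {n : ℕ} (hn : 0 < n) {T : ℝ} (hT : 0 < T)
    -- nonnegative price processes with right-continuous paths
    (S : Fin n → ℝ → Ω → ℝ)
    (hmeas : ∀ i, ∀ t ∈ Set.Icc 0 T, Measurable (S i t))
    (hnonneg : ∀ i, ∀ t ∈ Set.Icc 0 T, ∀ᵐ ω ∂Q, 0 ≤ S i t ω)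
    (hrc : ∀ i, ∀ᵐ ω ∂Q, ∀ t ∈ Set.Ico 0 T,
      ContinuousWithinAt (fun u => S i u ω) (Set.Ici t) t)
    -- the maxima over `[0,T]` are a.s. finite and have an expected value
    (hbdd : ∀ i, ∀ᵐ ω ∂Q, BddAbove (Set.range fun u : Set.Icc (0 : ℝ) T => S i u ω))
    (hmax : ∀ i, Integrable (fun ω => ⨆ u : Set.Icc (0 : ℝ) T, S i u ω) Q)
    -- the control measure is absolutely continuous
    (hac : controlMeasure Q S T ≪ volume)
    (K : Fin n → ℝ) :
    -- the prices involved are expectations of integrable payoffs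
    Integrable (asianBasketPayoff S T K) Q ∧
    (∀ t₀ t₁ : ℝ, 0 ≤ t₀ → t₀ ≤ t₁ → t₁ ≤ T → ∀ x,
      Integrable (lookbackPayoff S t₀ t₁ x) Q) ∧
    -- for each window, the first partial derivatives of the look-back price exist a.e.
    (∀ t₀ t₁ : ℝ, 0 ≤ t₀ → t₀ ≤ t₁ → t₁ ≤ T →
      ∀ᵐ x ∂(volume : Measure (Fin n → ℝ)), ∀ i, PartialExists i (lookbackPrice Q S t₀ t₁) x) ∧
    -- for a.e. `t`, the price at `s = 0⁺` and its first partial derivatives exist, and these are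
    -- also the limits, as `s → 0⁺`, of the one-sided partial derivatives at window length `s`
    (∀ᵐ t ∂(volume.restrict (Set.Ioo 0 T)), ∀ x ∈ positiveOrthant n,
      Tendsto (fun s => lookbackPrice Q S t (t + s) x) (𝓝[>] 0)
        (𝓝 (instantLookbackPrice Q S t x)) ∧
      ∀ i, PartialExists i (instantLookbackPrice Q S t) x ∧
        (∀ s, 0 < s → t + s ≤ T →
          DifferentiableWithinAt ℝ
            (fun y => lookbackPrice Q S t (t + s) (Function.update x i y)) (Set.Ioi (x i)) (x i) ∧
          DifferentiableWithinAt ℝ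
            (fun y => lookbackPrice Q S t (t + s) (Function.update x i y)) (Set.Iio (x i)) (x i)) ∧
        Tendsto (fun s => derivWithin
            (fun y => lookbackPrice Q S t (t + s) (Function.update x i y)) (Set.Ioi (x i)) (x i))
          (𝓝[>] 0) (𝓝 (partialDeriv i (instantLookbackPrice Q S t) x)) ∧
        Tendsto (fun s => derivWithin
            (fun y => lookbackPrice Q S t (t + s) (Function.update x i y)) (Set.Iio (x i)) (x i))
          (𝓝[>] 0) (𝓝 (partialDeriv i (instantLookbackPrice Q S t) x))) ∧
    -- for a.e. `(t, x)`, the further `n`-fold mixed derivative exists and is the density of the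
    -- control measure
    (∀ᵐ p ∂(volume.restrict (Set.Ioo 0 T ×ˢ positiveOrthant n)),
      IteratedPartialExists (List.finRange n) (sumLookbackPartials Q S p.1) p.2 ∧
      statePriceDensity Q S p.1 p.2 = ((controlMeasure Q S T).rnDeriv volume p).toReal) ∧
    -- the pricing formula
    (∀ i, IntegrableOn (fun p : ℝ × (Fin n → ℝ) =>
        max (p.2 i - K i) 0 * statePriceDensity Q S p.1 p.2)
      (Set.Ioo 0 T ×ˢ positiveOrthant n) volume) ∧
    asianBasketPrice Q S T K =
      ∑ i, ∫ t in (0 : ℝ)..T, ∫ x in positiveOrthant n,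
        max (x i - K i) 0 * statePriceDensity Q S t x := by
  have : NeZero n := ⟨hn.ne'⟩
  have hM : IsIntegrableMarket Q S T := ⟨hmeas, hrc, hbdd, hmax⟩
  refine ⟨hM.integrable_asianBasketPayoff hT.le K,
    fun t₀ t₁ h₀ h₀₁ h₁ x => hM.integrable_lookbackPayoff h₀ h₀₁ h₁ x,
    fun t₀ t₁ h₀ h₀₁ h₁ => hM.ae_partialExists_lookbackPrice h₀ h₀₁ h₁, ?_,
    hM.ae_statePriceDensity_eq hac,
    fun i => hM.integrableOn_call_mul_statePriceDensity hac K i, ?_⟩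
  · filter_upwards [hM.ae_noTies_and_cdf hac, ae_restrict_mem measurableSet_Ioo] with t ht htm x _
    have htm' : t ∈ Set.Ico 0 T := ⟨htm.1.le, htm.2⟩
    obtain ⟨h0, hinj, -⟩ := ht x
    rw [hM.instantLookbackPrice_eq htm']
    refine ⟨hM.tendsto_lookbackPrice htm' x, fun i => ?_⟩
    have hd := (hM.hasDerivAt_lookbackPrice_self (Set.Ico_subset_Icc_self htm') x h0 hinj i).2
    have hconv : ∀ s, 0 < s → t + s ≤ T → ConvexOn ℝ Set.univ
        fun y => lookbackPrice Q S t (t + s) (Function.update x i y) := fun s hs hsT =>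
      hM.convexOn_lookbackPrice_update htm.1.le (by linarith) hsT x i
    -- The zero-window price is differentiable at `x i` because ties and zeros have probability
    -- zero, which is what lets convexity pass to the limit of the one-sided derivatives.
    have hlim := tendsto_derivWithin_of_convexOn (l := 𝓝[>] (0 : ℝ))
      (φ := fun s y => lookbackPrice Q S t (t + s) (Function.update x i y)) (by
        filter_upwards [Ioo_mem_nhdsGT (sub_pos.2 htm.2)] with s hs
        exact hconv s hs.1 (by linarith [hs.2]))
      (fun z => hM.tendsto_lookbackPrice htm' _) hd
    rw [partialDeriv, hd.deriv]
    refine ⟨hd.differentiableAt, fun s hs hsT => ⟨?_, ?_⟩, hlim.1, hlim.2⟩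
    · exact (hconv s hs hsT).differentiableWithinAt_Ioi_of_mem_interior (by simp)
    · exact (hconv s hs hsT).differentiableWithinAt_Iio_of_mem_interior (by simp)
  · rw [hM.asianBasketPrice_eq hT.le K]
    exact Finset.sum_congr rfl fun i _ => hM.integral_call_controlMeasure hT.le hnonneg hac K i
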